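/- An $\mathcal F$-group is a finitely generated, torsion-free, nilpotent group. A radicable hull (rational Mal'cev completion) of an $\mathcal F$-group $N$ is a torsion-free nilpotent group $N^{\mathbb Q}\supseteq N$ in which every element has an $n$-th root for every $n>0$ and every element has a positive power lying in $N$. For an $\mathcal F$-group $N$ of nilpotency class $c$, let $I$ be the augmentation ideal of the group algebra $\mathbb Q[N]$, let $A=\mathbb Q[N]/I^{c+1}$, and let $\mathfrak n^{\mathbb Q}\subseteq A$ be the rational span of $\log(N)$, where $\log(g)=\sum_{k=1}^{c}\frac{(-1)^{k+1}}{k}(g-1)^k$; this is the rational Mal'cev Lie algebra of $N$. A homomorphism $\varphi:N\to N$ induces the linear map of $\mathfrak n^{\mathbb Q}$ determined by $\log(g)\mapsto\log(\varphi(g))$ for $g \in N$, and $\det(\varphi)$ denotes the determinant of this linear map. **Theorem.** Let $N_1$ and $N_2$ be $\mathcal F$-groups which are subgroups of a group $N^{\mathbb Q}$ that is a radicable hull of both $N_1$ and $N_2$. Then there is a finite set $\{p_1,\dots,p_l\}$ of primes such that the following holds for every injective homomorphism $\varphi:N_1\to N_1$. The determinant $\det(\varphi)$ is an integer, $\varphi$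 has a unique extension to a homomorphism $\varphi^{\mathbb Q}:N^{\mathbb Q}\to N^{\mathbb Q}$, and if $p_j\nmid\det(\varphi)$ for all $j\in\{1,\dots,l\}$, then there exists an integer $k>0$ with $(\varphi^{\mathbb Q})^k(N_2)\subseteq N_2$. -/

import Mathlib

noncomputable section

/-- An `𝓕`-group: a finitely generated, torsion-free, nilpotent group. -/
structure IsFGroup (N : Type*) [Group N] : Prop where
  fg : Group.FG N
  nilpotent : Group.IsNilpotent N
  torsionFree : ∀ g : N, IsOfFinOrder g → g = 1

/-- The ambient group `G` is a radicable hull (rational Mal'cev completion) of its subgroup `N`: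
`G` is a nilpotent torsion-free group in which every element has an `n`-th root for all `n > 0`,
and every element of `G` has a positive power in `N`. -/
structure IsRadicableHull {G : Type*} [Group G] (N : Subgroup G) : Prop where
  nilpotent : Group.IsNilpotent G
  torsionFree : ∀ g : G, IsOfFinOrder g → g = 1
  radicable : ∀ n : ℕ, 0 < n → ∀ g : G, ∃ h : G, h ^ n = g
  exists_pow_mem : ∀ g : G, ∃ n : ℕ, 0 < n ∧ g ^ n ∈ N

namespace Malcev

variable (N : Type*) [Group N]

/-- The augmentation `ℚ[N] → ℚ`, sending every element of `N` to `1`. -/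
def augmentation : MonoidAlgebra ℚ N →ₐ[ℚ] ℚ :=
  MonoidAlgebra.lift ℚ ℚ N 1

/-- The augmentation ideal `I` of the rational group algebra `ℚ[N]`. -/
def augIdeal : Ideal (MonoidAlgebra ℚ N) :=
  RingHom.ker (augmentation N)

instance : (augIdeal N).IsTwoSided := by
  unfold augIdeal; infer_instance

variable {N}

theorem augmentation_comp_map (φ : N →* N) :
    (augmentation N).comp (MonoidAlgebra.mapDomainAlgHom ℚ ℚ φ) = augmentation N := by
  ext; simp [augmentation]

theorem augIdeal_le_comap (φ : N →* N) :
    augIdeal N ≤ (augIdeal N).comap (MonoidAlgebra.mapDomainAlgHom ℚ ℚ φ) := by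
  intro x hx
  have h := DFunLike.congr_fun (augmentation_comp_map φ) x
  simp only [augIdeal, Ideal.mem_comap, RingHom.mem_ker] at hx ⊢
  rw [← hx, ← h]; rfl

theorem augIdeal_pow_le_comap (φ : N →* N) (m : ℕ) :
    (augIdeal N) ^ m ≤ ((augIdeal N) ^ m).comap (MonoidAlgebra.mapDomainAlgHom ℚ ℚ φ) := by
  induction m with
  | zero => intro x _; rw [Ideal.mem_comap, Submodule.pow_zero, Ideal.one_eq_top]; trivial
  | succ m ih =>
    rw [Submodule.pow_succ, Ideal.mul_le]
    intro r hr s hs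
    rw [Ideal.mem_comap, map_mul]
    exact Ideal.mul_mem_mul (ih hr) (augIdeal_le_comap φ hs)

variable (N)

/-- The truncated group algebra `ℚ[N] / I ^ (c + 1)`, where `c` is the nilpotency class of `N`.
For an `𝓕`-group `N` it is a finite-dimensional algebra, and `N` embeds into its group
of unipotent units. -/
abbrev TruncatedGroupAlgebra : Type _ :=
  MonoidAlgebra ℚ N ⧸ (augIdeal N) ^ (Group.nilpotencyClass N + 1)

variable {N}

/-- The image of a group element in the truncated group algebra. -/
def of (g : N) : TruncatedGroupAlgebra N :=
  Ideal.Quotient.mk _ (MonoidAlgebra.of ℚ N g)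

/-- The logarithm `log g = ∑_{k ≥ 1} (-1) ^ (k + 1) / k * (g - 1) ^ k` of a group element in the
truncated group algebra; the terms with `k > c` vanish. -/
def log (g : N) : TruncatedGroupAlgebra N :=
  ∑ k ∈ Finset.Icc 1 (Group.nilpotencyClass N), ((-1 : ℚ) ^ (k + 1) / k) • (of g - 1) ^ k

variable (N) in
/-- The rational span of `log N`, the underlying vector space of the rational Mal'cev Lie algebra
of `N`. -/
def lieAlg : Submodule ℚ (TruncatedGroupAlgebra N) :=
  Submodule.span ℚ (Set.range (log (N := N)))

/-- The endomorphism of the truncated group algebra induced by a group endomorphism. -/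
def algMap (φ : N →* N) : TruncatedGroupAlgebra N →ₐ[ℚ] TruncatedGroupAlgebra N :=
  Ideal.quotientMapₐ _ (MonoidAlgebra.mapDomainAlgHom ℚ ℚ φ) (augIdeal_pow_le_comap φ _)

theorem algMap_of (φ : N →* N) (g : N) : algMap φ (of g) = of (φ g) := by
  simp [algMap, of]

theorem algMap_log (φ : N →* N) (g : N) : algMap φ (log g) = log (φ g) := by
  simp [log, algMap_of]

theorem algMap_mem (φ : N →* N) :
    ∀ x ∈ lieAlg N, (algMap φ).toLinearMap x ∈ lieAlg N := by
  change lieAlg N ≤ (lieAlg N).comap (algMap φ).toLinearMap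
  refine Submodule.span_le.2 ?_
  rintro _ ⟨g, rfl⟩
  exact Submodule.subset_span ⟨φ g, (algMap_log φ g).symm⟩

/-- The linear endomorphism of the rational Mal'cev Lie algebra of `N` induced by `φ : N →* N`.
It is the unique linear map sending `log g` to `log (φ g)` for all `g` in `N`. -/
def lieMap (φ : N →* N) : lieAlg N →ₗ[ℚ] lieAlg N :=
  (algMap φ).toLinearMap.restrict (algMap_mem φ)

/-- The determinant of an endomorphism `φ` of an `𝓕`-group `N`: the determinant of the induced
endomorphism of the rational Mal'cev Lie algebra of `N`. -/
def det (φ : N →* N) : ℚ :=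
  LinearMap.det (lieMap φ)

end Malcev

end

-- Put `A = ℚ[N₁]/I^(c+1)`. The unipotent units of `A` form a nilpotent, torsion-free, radicable
-- group into which `N₁` embeds, so the embedding extends to a faithful `ρ : G → A`. If `α` is the
-- algebra endomorphism of `A` induced by `φ`, uniqueness of roots gives `ρ ∘ φQ = α ∘ ρ`. The
-- `ℤ`-span `L` of `log N₁` is a finitely generated `α`-stable lattice, so `det φ` is an integer
-- `d`, and the adjugate matrix gives `d L ⊆ α(L)`.
--
-- Let `B` be the subring generated by `L`; it is additively finitely generated because `L` lies in
-- a nilpotent ideal. Let `B₂ ⊇ B` be a subring, also additively finitely generated, that contains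
-- `ρ(N₂)`. Some `m > 0` satisfies `m B₂ ⊆ B`, and some `n > 0` is such that `ρ w ∈ 1 + n B₂` forces
-- `w ∈ N₂`. The exceptional primes are those dividing `mn`. If `d` is prime to `mn`, then `L = α(L)
-- + mn L`, hence `B = α(B) + mn B`; so `α` permutes the finite ring `B/mnB` and a power `α^k` is
-- the identity there. Applied to `m ρ(x)` with `x ∈ N₂`, this gives `ρ(φQ^k x) - ρ(x) ∈ n B`,
-- whence `x⁻¹ φQ^k(x) ∈ N₂`.
--
-- Two facts carry the weight. Faithfulness on `N₁` (`Malcev.eq_one_of_of_sub_one_mem`) comes from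
-- polynomial functions of degree at most `c`, which separate points and whose linear extensions
-- kill `I^(c+1)`. The congruence property (`exists_mem_of_map_sub_one_eq_nsmul`) is proved by
-- induction along the powers of the augmentation ideal.

universe u v

/-! ### Roots, powers and isolators in nilpotent groups. -/

namespace Subgroup

open scoped commutatorElement

theorem commutatorElement_pow_left {G : Type*} [Group G] {a b : G} (h : Commute a ⁅a, b⁆) (n : ℕ) :
    ⁅a ^ n, b⁆ = ⁅a, b⁆ ^ n := by
  induction n with
  | zero => simp
  | succ n ih =>
    rw [pow_succ, commutatorElement_mul_left_eq_conj_mul, ih, (h.pow_left n).eq, mul_assoc _ (a ^ n),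
      mul_inv_cancel, mul_one, pow_succ']

theorem commutatorElement_pow_right {G : Type*} [Group G] {a b : G} (h : Commute b ⁅a, b⁆) (n : ℕ) :
    ⁅a, b ^ n⁆ = ⁅a, b⁆ ^ n := by
  have h' : Commute b ⁅b, a⁆ := by
    rw [← commutatorElement_inv]; exact h.inv_right
  rw [← inv_inj, commutatorElement_inv, commutatorElement_pow_left h' n, ← inv_pow,
    commutatorElement_inv]

theorem exists_pow_mem_of_mem_closure_of_subset_center {G : Type*} [Group G] (H : Subgroup G)
    {S : Set G} (hS : S ⊆ center G) (h : ∀ s ∈ S, ∃ n : ℕ, 0 < n ∧ s ^ n ∈ H) {z : G}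
    (hz : z ∈ closure S) : ∃ n : ℕ, 0 < n ∧ z ^ n ∈ H := by
  induction hz using closure_induction with
  | mem x hx => exact h x hx
  | one => exact ⟨1, one_pos, by simp⟩
  | mul x y hx hy ihx ihy =>
    obtain ⟨m, hm, hxm⟩ := ihx
    obtain ⟨n, hn, hyn⟩ := ihy
    have hxc : x ∈ center G := (closure_le _).2 hS hx
    have hc : Commute x y := (mem_center_iff.1 hxc y).symm
    refine ⟨m * n, Nat.mul_pos hm hn, ?_⟩
    rw [hc.mul_pow]
    exact H.mul_mem (by rw [pow_mul]; exact H.pow_mem hxm n)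
      (by rw [mul_comm, pow_mul]; exact H.pow_mem hyn m)
  | inv x hx ihx =>
    obtain ⟨m, hm, hxm⟩ := ihx
    exact ⟨m, hm, by rw [inv_pow]; exact H.inv_mem hxm⟩

theorem lowerCentralSeries_le_center {G : Type*} [Group G] {c : ℕ}
    (hc : (⊤ : Subgroup G).lowerCentralSeries (c + 1) = ⊥) :
    (⊤ : Subgroup G).lowerCentralSeries c ≤ center G :=
  commutator_top_right_eq_bot_iff_le_center.1 hc

theorem lowerCentralSeries_quotient_eq_bot {G : Type*} [Group G] (c : ℕ) :
    (⊤ : Subgroup (G ⧸ (⊤ : Subgroup G).lowerCentralSeries c)).lowerCentralSeries c = ⊥ := by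
  have h := map_lowerCentralSeries (⊤ : Subgroup G)
    (QuotientGroup.mk' ((⊤ : Subgroup G).lowerCentralSeries c)) c
  rw [← MonoidHom.range_eq_map, QuotientGroup.range_mk'] at h
  rw [← h, Subgroup.map_eq_bot_iff, QuotientGroup.ker_mk']

/-- Induction on the class: modulo the last term `Z` of the lower central series the claim is known,
so `g ^ n = h * z` with `h ∈ H` and `z ∈ Z`. It remains to treat `Z`. If `G` is abelian, the
generators `X` suffice. Otherwise `Z` is generated by central commutators, and from `p ^ m = h * z`,
`q ^ n = h' * z'` one gets `⁅p, q⁆ ^ (m * n) = ⁅p ^ m, q ^ n⁆ = ⁅h, h'⁆ ∈ H`, the central factors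
dropping out. -/
theorem exists_pow_mem_of_closure_eq_top_aux (c : ℕ) : ∀ {G : Type u} [Group G],
    (⊤ : Subgroup G).lowerCentralSeries c = ⊥ → ∀ (H : Subgroup G) (X : Set G), closure X = ⊤ →
      (∀ x ∈ X, ∃ n : ℕ, 0 < n ∧ x ^ n ∈ H) → ∀ g : G, ∃ n : ℕ, 0 < n ∧ g ^ n ∈ H := by
  induction c with
  | zero =>
    intro G _ hG H X _ _ g
    have : g ∈ (⊥ : Subgroup G) := hG ▸ mem_top g
    exact ⟨1, one_pos, by rw [mem_bot.1 this, one_pow]; exact H.one_mem⟩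
  | succ c ih =>
    intro G _ hG H X hX hXH g
    have hcen := lowerCentralSeries_le_center hG
    have key : ∀ g : G, ∃ n : ℕ, 0 < n ∧
        ∃ h ∈ H, ∃ z ∈ (⊤ : Subgroup G).lowerCentralSeries c, g ^ n = h * z := by
      intro g
      obtain ⟨n, hn, hgn⟩ := ih (lowerCentralSeries_quotient_eq_bot (G := G) c)
        (H.map (QuotientGroup.mk' _)) (QuotientGroup.mk' _ '' X)
        (by rw [← MonoidHom.map_closure, hX, ← MonoidHom.range_eq_map, QuotientGroup.range_mk'])
        (by
          rintro _ ⟨x, hx, rfl⟩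
          obtain ⟨n, hn, hxn⟩ := hXH x hx
          exact ⟨n, hn, by rw [← map_pow]; exact mem_map_of_mem _ hxn⟩)
        (QuotientGroup.mk' _ g)
      rw [← map_pow] at hgn
      obtain ⟨h, hh, hhg⟩ := hgn
      refine ⟨n, hn, h, hh, h⁻¹ * g ^ n, ?_, by group⟩
      exact QuotientGroup.eq.1 hhg
    have hz : ∀ z ∈ (⊤ : Subgroup G).lowerCentralSeries c, ∃ n : ℕ, 0 < n ∧ z ^ n ∈ H := by
      intro z hz
      cases c with
      | zero =>
        refine exists_pow_mem_of_mem_closure_of_subset_center H (S := X) ?_ hXH (hX ▸ mem_top z)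
        exact fun x _ => hcen (mem_top x)
      | succ c =>
        rw [mem_lowerCentralSeries_succ_iff] at hz
        refine exists_pow_mem_of_mem_closure_of_subset_center H ?_ ?_ hz
        · rintro _ ⟨p, hp, q, hq, rfl⟩
          exact hcen (commutator_mem_commutator hp hq)
        · rintro _ ⟨p, hp, q, hq, rfl⟩
          have hpq : ∀ x, Commute x ⁅p, q⁆ := fun x =>
            mem_center_iff.1 (hcen (commutator_mem_commutator hp hq)) x
          obtain ⟨m, hm, h, hh, z, hz, hpm⟩ := key p
          obtain ⟨n, hn, h', hh', z', hz', hqn⟩ := key q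
          refine ⟨m * n, Nat.mul_pos hm hn, ?_⟩
          have h1 : ⁅p ^ m, q ^ n⁆ = ⁅p, q⁆ ^ (m * n) := by
            rw [commutatorElement_pow_left, commutatorElement_pow_right (hpq _), ← pow_mul, mul_comm]
            rw [commutatorElement_pow_right (hpq _)]
            exact (hpq _).pow_right n
          have hzc := fun x => mem_center_iff.1 (hcen hz) x
          have hzc' := fun x => mem_center_iff.1 (hcen hz') x
          have h2 : ⁅p ^ m, q ^ n⁆ = ⁅h, h'⁆ := by
            rw [hpm, hqn, commutatorElement_mul_left_eq_conj_mul,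
              commutatorElement_eq_one_iff_mul_comm.2 (hzc _).symm,
              commutatorElement_mul_right_eq_mul_conj,
              commutatorElement_eq_one_iff_mul_comm.2 (hzc' _)]
            group
          rw [← h1, h2, commutatorElement_def]
          exact H.mul_mem (H.mul_mem (H.mul_mem hh hh') (H.inv_mem hh)) (H.inv_mem hh')
    obtain ⟨n, hn, h, hh, z, hzm, hgn⟩ := key g
    obtain ⟨m, hm, hzH⟩ := hz z hzm
    refine ⟨n * m, Nat.mul_pos hn hm, ?_⟩
    have hc : Commute h z := mem_center_iff.1 (hcen hzm) h
    rw [pow_mul, hgn, hc.mul_pow]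
    exact H.mul_mem (H.pow_mem hh m) hzH

/-- In a nilpotent group, if every element of a generating set has a positive power in the
subgroup `H`, then so does every element. -/
theorem exists_pow_mem_of_closure_eq_top {G : Type u} [Group G] [hG : Group.IsNilpotent G]
    (H : Subgroup G) (X : Set G) (hX : closure X = ⊤)
    (h : ∀ x ∈ X, ∃ n : ℕ, 0 < n ∧ x ^ n ∈ H) (g : G) : ∃ n : ℕ, 0 < n ∧ g ^ n ∈ H := by
  obtain ⟨c, hc⟩ := nilpotent_iff_lowerCentralSeries.1 hG
  exact exists_pow_mem_of_closure_eq_top_aux c hc H X hX h g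

/-- The isolator of a subgroup `H` of a nilpotent group: the elements having a positive power
in `H`. -/
def isolator {G : Type u} [Group G] [Group.IsNilpotent G] (H : Subgroup G) : Subgroup G where
  carrier := {g | ∃ n : ℕ, 0 < n ∧ g ^ n ∈ H}
  one_mem' := ⟨1, one_pos, by simp⟩
  inv_mem' := by
    rintro x ⟨n, hn, hx⟩
    exact ⟨n, hn, by rw [inv_pow]; exact H.inv_mem hx⟩
  mul_mem' := by
    intro x y hx hy
    -- The preceding result is applied inside the nilpotent group generated by `x` and `y`.
    have hX : ∀ z ∈ ((↑) ⁻¹' ({x, y} : Set G) : Set (closure ({x, y} : Set G))),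
        ∃ n : ℕ, 0 < n ∧ z ^ n ∈ H.subgroupOf (closure ({x, y} : Set G)) := by
      rintro z (h | h)
      · obtain ⟨n, hn, hxn⟩ := hx
        exact ⟨n, hn, by rw [mem_subgroupOf, coe_pow, h]; exact hxn⟩
      · obtain ⟨n, hn, hyn⟩ := hy
        exact ⟨n, hn, by rw [mem_subgroupOf, coe_pow, h]; exact hyn⟩
    exact exists_pow_mem_of_closure_eq_top _ _ closure_closure_coe_preimage hX
      (⟨x, subset_closure (by simp)⟩ * ⟨y, subset_closure (by simp)⟩)

/-- Climb the upper central series: by induction `g` commutes with `⁅h, g⁆`, so `⁅h, g⁆ ^ n = ⁅h, g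
^ n⁆ = 1`, and torsion-freeness applies. Consequently the quotient by the center is again
torsion-free, which drives the induction for uniqueness of roots. -/
theorem commute_of_pow_mem_center {G : Type*} [Group G] (hG : Group.IsNilpotent G)
    (htf : ∀ g : G, IsOfFinOrder g → g = 1) {g : G} {n : ℕ} (hn : 0 < n) (hg : g ^ n ∈ center G)
    (h : G) : Commute g h := by
  have key : ∀ i, ∀ h ∈ upperCentralSeries G i, Commute g h := by
    intro i
    induction i with
    | zero =>
      intro h hh
      rw [upperCentralSeries_zero, mem_bot] at hh
      rw [hh]; exact Commute.one_right g
    | succ i ih =>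
      intro h hh
      have h1 : ⁅h, g⁆ ∈ upperCentralSeries G i := mem_upperCentralSeries_succ_iff.1 hh g
      have h2 : Commute g ⁅h, g⁆ := ih _ h1
      have h3 : ⁅h, g ^ n⁆ = ⁅h, g⁆ ^ n := commutatorElement_pow_right h2 n
      have h4 : ⁅h, g ^ n⁆ = 1 :=
        commutatorElement_eq_one_iff_mul_comm.2 (mem_center_iff.1 hg h)
      have h5 : ⁅h, g⁆ = 1 := htf _ (isOfFinOrder_iff_pow_eq_one.2 ⟨n, hn, by rw [← h3, h4]⟩)
      exact (commutatorElement_eq_one_iff_commute.1 h5).symm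
  obtain ⟨i, hi⟩ := hG.nilpotent
  exact key i h (hi ▸ mem_top h)

theorem eq_of_pow_eq_pow_aux : ∀ (G : Type u) [Group G] [Group.IsNilpotent G],
    (∀ g : G, IsOfFinOrder g → g = 1) → ∀ (n : ℕ), 0 < n → ∀ x y : G, x ^ n = y ^ n → x = y := by
  refine fun G _ _ => Group.nilpotent_center_quotient_ind
    (P := fun G _ _ => (∀ g : G, IsOfFinOrder g → g = 1) →
      ∀ (n : ℕ), 0 < n → ∀ x y : G, x ^ n = y ^ n → x = y) G ?_ ?_
  · intro G _ _ _ n _ x y _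
    exact Subsingleton.elim x y
  · intro G _ hN ih htf n hn x y hxy
    have h1 : (QuotientGroup.mk x : G ⧸ center G) = QuotientGroup.mk y := by
      refine ih ?_ n hn _ _ ?_
      · intro g hg
        obtain ⟨g, rfl⟩ := QuotientGroup.mk_surjective g
        obtain ⟨m, hm, hgm⟩ := isOfFinOrder_iff_pow_eq_one.1 hg
        rw [← QuotientGroup.mk_pow, QuotientGroup.eq_one_iff] at hgm
        rw [QuotientGroup.eq_one_iff, mem_center_iff]
        exact fun h => (commute_of_pow_mem_center hN htf hm hgm h).symm
      · rw [← QuotientGroup.mk_pow, hxy, QuotientGroup.mk_pow]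
    rw [QuotientGroup.eq] at h1
    have hc : Commute x (x⁻¹ * y) := mem_center_iff.1 h1 x
    have h2 : y ^ n = x ^ n * (x⁻¹ * y) ^ n := by
      rw [← hc.mul_pow]; group
    have h3 : (x⁻¹ * y) ^ n = 1 := by
      rw [hxy] at h2; simpa using h2
    have h4 := htf _ (isOfFinOrder_iff_pow_eq_one.2 ⟨n, hn, h3⟩)
    exact inv_mul_eq_one.1 h4

/-- Roots are unique in torsion-free nilpotent groups. -/
theorem eq_of_pow_eq_pow {G : Type u} [Group G] [Group.IsNilpotent G]
    (htf : ∀ g : G, IsOfFinOrder g → g = 1) {n : ℕ} (hn : 0 < n) {x y : G} (h : x ^ n = y ^ n) :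
    x = y :=
  eq_of_pow_eq_pow_aux G htf n hn x y h

theorem commute_of_commute_pow {G : Type u} [Group G] [Group.IsNilpotent G]
    (htf : ∀ g : G, IsOfFinOrder g → g = 1) {n : ℕ} (hn : 0 < n) {x y : G}
    (h : Commute (x ^ n) y) : Commute x y := by
  have h1 : (y * x * y⁻¹) ^ n = x ^ n := by
    rw [conj_pow, ← h.eq]; group
  have h2 := eq_of_pow_eq_pow htf hn h1
  exact (mul_inv_eq_iff_eq_mul.1 h2).symm

/-! ### Lower central series commutators and finite generation of subgroups. -/

theorem commutator_commutator_le_of_rotate {G : Type*} [Group G] {H₁ H₂ H₃ N : Subgroup G}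
    [N.Normal] (h1 : ⁅⁅H₂, H₃⁆, H₁⁆ ≤ N) (h2 : ⁅⁅H₃, H₁⁆, H₂⁆ ≤ N) : ⁅⁅H₁, H₂⁆, H₃⁆ ≤ N := by
  have hk : ∀ K : Subgroup G, K ≤ N ↔ K.map (QuotientGroup.mk' N) = ⊥ := fun K => by
    rw [Subgroup.map_eq_bot_iff, QuotientGroup.ker_mk']
  rw [hk, map_commutator, map_commutator] at h1 h2 ⊢
  exact commutator_commutator_eq_bot_of_rotate h1 h2

theorem commutator_lowerCentralSeries_le {G : Type*} [Group G] (i j : ℕ) :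
    ⁅(⊤ : Subgroup G).lowerCentralSeries i, (⊤ : Subgroup G).lowerCentralSeries j⁆ ≤
      (⊤ : Subgroup G).lowerCentralSeries (i + j + 1) := by
  induction j generalizing i with
  | zero => exact le_rfl
  | succ j ih =>
    rw [commutator_comm, lowerCentralSeries_succ]
    refine commutator_commutator_le_of_rotate ?_ ?_
    · rw [commutator_comm ⊤, ← lowerCentralSeries_succ]
      refine (ih (i + 1)).trans (le_of_eq ?_)
      congr 1; ring
    · refine (commutator_mono (ih i) le_rfl).trans (le_of_eq ?_)
      rw [← lowerCentralSeries_succ]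
      congr 1

theorem fg_of_fg_map_of_fg_inf {G : Type*} [Group G] {H Z : Subgroup G} [Z.Normal]
    (h1 : (H.map (QuotientGroup.mk' Z)).FG) (h2 : (H ⊓ Z).FG) : H.FG := by
  classical
  obtain ⟨S, hS⟩ := h1
  have hlift : ∀ s ∈ S, ∃ h ∈ H, QuotientGroup.mk' Z h = s := fun s hs => by
    have : s ∈ H.map (QuotientGroup.mk' Z) := hS ▸ subset_closure hs
    exact this
  choose! f hfH hfs using hlift
  have hle : closure (f '' S) ≤ H := by
    rw [closure_le]; rintro _ ⟨s, hs, rfl⟩; exact hfH s hs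
  have hH : H = closure (f '' S) ⊔ (H ⊓ Z) := by
    refine le_antisymm ?_ (sup_le hle inf_le_left)
    intro h hh
    have h3 : QuotientGroup.mk' Z h ∈ (closure (f '' S)).map (QuotientGroup.mk' Z) := by
      have h4 : (closure (f '' S)).map (QuotientGroup.mk' Z) = closure S := by
        rw [MonoidHom.map_closure, Set.image_image]
        congr 1
        ext s
        constructor
        · rintro ⟨t, ht, rfl⟩; simpa only [hfs t ht] using ht
        · exact fun hs => ⟨s, hs, hfs s hs⟩
      rw [h4, hS]
      exact mem_map_of_mem _ hh
    obtain ⟨k, hk, hkh⟩ := h3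
    have h5 : k⁻¹ * h ∈ Z := QuotientGroup.eq.1 hkh
    have h6 : h = k * (k⁻¹ * h) := by group
    rw [h6]
    exact mul_mem_sup hk ⟨H.mul_mem (H.inv_mem (hle hk)) hh, h5⟩
  rw [hH]
  refine Subgroup.FG.sup ?_ h2
  exact (Subgroup.fg_iff _).2 ⟨_, rfl, S.finite_toSet.image f⟩

theorem fg_of_le_of_le_center {G : Type*} [Group G] {H Z : Subgroup G} (hZ : Z.FG)
    (hc : Z ≤ center G) (hH : H ≤ Z) : H.FG := by
  let : CommGroup Z :=
    { (inferInstance : Group Z) with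
      mul_comm := fun a b => Subtype.ext (mem_center_iff.1 (hc b.2) a) }
  have : Group.FG Z := (Group.fg_iff_subgroup_fg Z).2 hZ
  have : AddGroup.FG (Additive Z) := GroupFG.iff_add_fg.1 inferInstance
  have : Module.Finite ℤ (Additive Z) := Module.Finite.iff_addGroup_fg.2 inferInstance
  have h1 : (AddSubgroup.toIntSubmodule (Subgroup.toAddSubgroup (H.subgroupOf Z))).FG :=
    IsNoetherian.noetherian _
  rw [Submodule.fg_iff_addSubgroup_fg] at h1
  have h2 : (H.subgroupOf Z).FG := (Subgroup.fg_iff_add_fg _).2 h1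
  have h3 : ((H.subgroupOf Z).map Z.subtype).FG := by
    obtain ⟨S, hS, hf⟩ := (Subgroup.fg_iff _).1 h2
    rw [← hS, MonoidHom.map_closure]
    exact (Subgroup.fg_iff _).2 ⟨_, rfl, hf.image _⟩
  rwa [Subgroup.map_subgroupOf_eq_of_le hH] at h3

/-- The point is that the last term `Z` of the lower central series is finitely generated. As `Z` is
central, the commutator is bimultiplicative on (preceding term) × `G` and ignores factors from `Z`
on the left. So `Z` is generated by the commutators of lifts `f a` of generators of the preceding
layer with generators `b` of `G`. A subgroup `H` is then handled through its image modulo `Z` and `H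
⊓ Z`. -/
theorem fg_of_isNilpotent_aux (c : ℕ) : ∀ {G : Type u} [Group G],
    (⊤ : Subgroup G).lowerCentralSeries c = ⊥ → Group.FG G → ∀ H : Subgroup G, H.FG := by
  induction c with
  | zero =>
    intro G _ hG _ H
    have : H = ⊥ := eq_bot_iff.2 (hG ▸ le_top)
    rw [this]; exact Subgroup.FG.bot
  | succ c ih =>
    intro G _ hG hfg H
    have hcen := lowerCentralSeries_le_center hG
    have hQ := ih (lowerCentralSeries_quotient_eq_bot (G := G) c) inferInstance
    have hZ : ((⊤ : Subgroup G).lowerCentralSeries c).FG := by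
      cases c with
      | zero => exact Group.fg_def.1 hfg
      | succ c =>
        obtain ⟨A, hA⟩ := hQ (((⊤ : Subgroup G).lowerCentralSeries c).map (QuotientGroup.mk' _))
        have hlift : ∀ s ∈ A, ∃ h ∈ (⊤ : Subgroup G).lowerCentralSeries c,
            QuotientGroup.mk' ((⊤ : Subgroup G).lowerCentralSeries (c + 1)) h = s := fun s hs => by
          have : s ∈ ((⊤ : Subgroup G).lowerCentralSeries c).map (QuotientGroup.mk' _) :=
            hA ▸ subset_closure hs
          exact this
        choose! f hfH hfs using hlift
        obtain ⟨B, hB, hBf⟩ := Group.fg_iff.1 hfg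
        set K : Subgroup G := closure (Set.image2 (fun a b => ⁅f a, b⁆) A B) with hK
        have hKle : K ≤ (⊤ : Subgroup G).lowerCentralSeries (c + 1) := by
          rw [hK, closure_le]
          rintro _ ⟨a, ha, b, _, rfl⟩
          exact commutator_mem_commutator (hfH a ha) (mem_top b)
        have hKc : K ≤ center G := hKle.trans hcen
        have hconj : ∀ k ∈ K, ∀ g : G, g * k * g⁻¹ ∈ K := fun k hk g => by
          rw [mem_center_iff.1 (hKc hk) g]; simpa using hk
        have hleft : ∀ a ∈ A, ∀ b : G, ⁅f a, b⁆ ∈ K := by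
          intro a ha b
          have hb : b ∈ closure B := hB ▸ mem_top b
          induction hb using closure_induction with
          | mem b hb => exact subset_closure ⟨a, ha, b, hb, rfl⟩
          | one => rw [commutatorElement_one_right]; exact K.one_mem
          | mul x y _ _ hx hy =>
            rw [commutatorElement_mul_right_eq_mul_conj, mul_assoc, mul_assoc]
            exact K.mul_mem hx (by rw [← mul_assoc]; exact hconj _ hy x)
          | inv x _ hx =>
            have h1 : ⁅f a, x⁻¹⁆ = x⁻¹ * ⁅f a, x⁆⁻¹ * x⁻¹⁻¹ := by
              simp [commutatorElement_def, mul_assoc]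
            rw [h1]
            exact hconj _ (K.inv_mem hx) _
        have hall : ∀ a ∈ (⊤ : Subgroup G).lowerCentralSeries c, ∀ b : G, ⁅a, b⁆ ∈ K := by
          intro a ha b
          have hmem : QuotientGroup.mk' ((⊤ : Subgroup G).lowerCentralSeries (c + 1)) a ∈
              closure (A : Set _) := hA ▸ mem_map_of_mem _ ha
          have hcl : ∀ a' ∈ closure (f '' A), ⁅a', b⁆ ∈ K := by
            intro a' ha'
            induction ha' using closure_induction with
            | mem x hx => obtain ⟨s, hs, rfl⟩ := hx; exact hleft s hs b
            | one => rw [commutatorElement_one_left]; exact K.one_mem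
            | mul x y _ _ hx hy =>
              rw [commutatorElement_mul_left_eq_conj_mul]
              exact K.mul_mem (hconj _ hy x) hx
            | inv x _ hx =>
              have h1 : ⁅x⁻¹, b⁆ = x⁻¹ * ⁅x, b⁆⁻¹ * x⁻¹⁻¹ := by
                simp [commutatorElement_def, mul_assoc]
              rw [h1]
              exact hconj _ (K.inv_mem hx) _
          have h4 : (closure (f '' A)).map
              (QuotientGroup.mk' ((⊤ : Subgroup G).lowerCentralSeries (c + 1))) = closure A := by
            rw [MonoidHom.map_closure, Set.image_image]
            congr 1
            ext s
            constructor
            · rintro ⟨t, ht, rfl⟩; simpa only [hfs t ht] using ht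
            · exact fun hs => ⟨s, hs, hfs s hs⟩
          rw [← h4] at hmem
          obtain ⟨k, hk, hka⟩ := hmem
          have h5 : k⁻¹ * a ∈ (⊤ : Subgroup G).lowerCentralSeries (c + 1) := QuotientGroup.eq.1 hka
          have h6 : a = k * (k⁻¹ * a) := by group
          rw [h6, commutatorElement_mul_left_eq_conj_mul,
            commutatorElement_eq_one_iff_mul_comm.2 (mem_center_iff.1 (hcen h5) b).symm]
          simpa using hcl k hk
        have hKeq : (⊤ : Subgroup G).lowerCentralSeries (c + 1) = K := by
          refine le_antisymm ?_ hKle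
          rw [lowerCentralSeries_succ, commutator_le]
          exact fun a ha b _ => hall a ha b
        rw [hKeq]
        exact (Subgroup.fg_iff _).2 ⟨_, rfl, (A.finite_toSet.image2 _ hBf)⟩
    exact fg_of_fg_map_of_fg_inf (hQ _) (fg_of_le_of_le_center hZ hcen inf_le_right)

/-- Every subgroup of a finitely generated nilpotent group is finitely generated. -/
theorem fg_of_isNilpotent {G : Type u} [Group G] [hG : Group.IsNilpotent G] [hfg : Group.FG G]
    (H : Subgroup G) : H.FG := by
  obtain ⟨c, hc⟩ := nilpotent_iff_lowerCentralSeries.1 hG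
  exact fg_of_isNilpotent_aux c hc hfg H

/-! ### Unique extension of homomorphisms to radicable hulls. -/

theorem monoidHom_ext_of_pow_mem {G : Type u} {U : Type v} [Group G] [Group U]
    [Group.IsNilpotent U] (htf : ∀ g : U, IsOfFinOrder g → g = 1) {N : Subgroup G}
    (hN : ∀ g : G, ∃ n : ℕ, 0 < n ∧ g ^ n ∈ N) {f₁ f₂ : G →* U} (h : ∀ x ∈ N, f₁ x = f₂ x) :
    f₁ = f₂ := by
  ext g
  obtain ⟨n, hn, hg⟩ := hN g
  refine eq_of_pow_eq_pow htf hn ?_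
  rw [← map_pow, ← map_pow, h _ hg]

/-- A homomorphism into a radicable torsion-free nilpotent group extends from a subgroup `N` of a
nilpotent group `G` to all of `G`, if every element of `G` has a positive power in `N`. -/
theorem exists_extension_of_pow_mem {G : Type u} {U : Type v} [Group G] [Group U]
    [Group.IsNilpotent G] [Group.IsNilpotent U] (htf : ∀ g : U, IsOfFinOrder g → g = 1)
    (hrad : ∀ n : ℕ, 0 < n → ∀ g : U, ∃ h : U, h ^ n = g) {N : Subgroup G}
    (hN : ∀ g : G, ∃ n : ℕ, 0 < n ∧ g ^ n ∈ N) (f : N →* U) :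
    ∃ F : G →* U, ∀ x : N, F x = f x := by
  -- The extension has as its graph the isolator of the graph of `f`: roots in `U` make it total,
  -- torsion-freeness of `U` makes it single-valued, and being a subgroup makes it multiplicative.
  set Γ : Subgroup (G × U) := (N.subtype.prod f).range with hΓ
  have htot : ∀ g : G, ∃ u : U, (g, u) ∈ isolator Γ := by
    intro g
    obtain ⟨n, hn, hg⟩ := hN g
    obtain ⟨u, hu⟩ := hrad n hn (f ⟨g ^ n, hg⟩)
    exact ⟨u, n, hn, ⟨⟨g ^ n, hg⟩, by simp [hu]⟩⟩
  have huniq : ∀ g : G, ∀ u v : U, (g, u) ∈ isolator Γ → (g, v) ∈ isolator Γ → u = v := by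
    intro g u v hu hv
    obtain ⟨n, hn, ⟨x, hx⟩⟩ := (isolator Γ).mul_mem ((isolator Γ).inv_mem hu) hv
    have h1 := congrArg Prod.fst hx
    have h2 := congrArg Prod.snd hx
    simp only [MonoidHom.prod_apply, Prod.pow_fst, Prod.fst_mul, Prod.fst_inv, inv_mul_cancel,
      one_pow, Subgroup.coe_subtype, Prod.pow_snd, Prod.snd_mul, Prod.snd_inv] at h1 h2
    have h3 : x = 1 := Subtype.ext h1
    rw [h3, map_one] at h2
    exact inv_mul_eq_one.1 (htf _ (isOfFinOrder_iff_pow_eq_one.2 ⟨n, hn, h2.symm⟩))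
  choose F hF using htot
  refine ⟨MonoidHom.mk' F fun a b => ?_, fun x => ?_⟩
  · exact huniq (a * b) _ _ (hF _) ((isolator Γ).mul_mem (hF a) (hF b))
  · exact huniq x _ _ (hF x) ⟨1, one_pos, ⟨x, by simp⟩⟩

end Subgroup

/-! ### Polynomial functions on filtered groups. -/

namespace Subgroup

open scoped commutatorElement

/-- `IsPolynomialOn E M k f` says that the restriction of `f` to the subgroup `M` is polynomial of
degree less than `k` with respect to the filtration `E`, an element of `E i` having weight
`i + 1`. -/
def IsPolynomialOn {N : Type*} [Group N] (E : ℕ → Subgroup N) (M : Subgroup N) :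
    ℕ → (N → ℚ) → Prop
  | 0, f => ∀ x ∈ M, f x = 0
  | k + 1, f => ∀ i, ∀ g ∈ M, g ∈ E i → IsPolynomialOn E M (k - i) (fun x => f (x * g) - f x)
termination_by k => k
decreasing_by omega

namespace IsPolynomialOn

variable {N : Type*} [Group N] {E : ℕ → Subgroup N} {M : Subgroup N}

theorem zero_iff {f : N → ℚ} : IsPolynomialOn E M 0 f ↔ ∀ x ∈ M, f x = 0 := by
  rw [IsPolynomialOn]

theorem succ_iff {k : ℕ} {f : N → ℚ} : IsPolynomialOn E M (k + 1) f ↔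
    ∀ i, ∀ g ∈ M, g ∈ E i → IsPolynomialOn E M (k - i) (fun x => f (x * g) - f x) := by
  rw [IsPolynomialOn]

theorem congr {k : ℕ} {f f' : N → ℚ} (h : IsPolynomialOn E M k f) (hf : ∀ x ∈ M, f x = f' x) :
    IsPolynomialOn E M k f' := by
  induction k using Nat.strong_induction_on generalizing f f' with
  | _ k ih =>
    cases k with
    | zero =>
      rw [zero_iff] at h ⊢
      exact fun x hx => (hf x hx).symm.trans (h x hx)
    | succ k =>
      rw [succ_iff] at h ⊢
      exact fun i g hg hgi => ih (k - i) (by omega) (h i g hg hgi) fun x hx => by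
        rw [hf x hx, hf _ (M.mul_mem hx hg)]

theorem of_eq_zero {f : N → ℚ} (hf : ∀ x ∈ M, f x = 0) (k : ℕ) : IsPolynomialOn E M k f := by
  induction k using Nat.strong_induction_on generalizing f with
  | _ k ih =>
    cases k with
    | zero => exact zero_iff.2 hf
    | succ k =>
      exact succ_iff.2 fun i g hg _ => ih (k - i) (by omega) fun x hx => by
        rw [hf x hx, hf _ (M.mul_mem hx hg), sub_zero]

theorem succ {k : ℕ} {f : N → ℚ} (h : IsPolynomialOn E M k f) : IsPolynomialOn E M (k + 1) f := by
  induction k using Nat.strong_induction_on generalizing f with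
  | _ k ih =>
    cases k with
    | zero => exact of_eq_zero (zero_iff.1 h) _
    | succ k =>
      rw [succ_iff] at h ⊢
      intro i g hg hgi
      have h1 := h i g hg hgi
      rcases le_or_gt i k with hik | hik
      · rw [Nat.sub_add_comm hik]
        exact ih (k - i) (by omega) h1
      · rw [show k + 1 - i = k - i by omega]
        exact h1

theorem mono {k l : ℕ} (hkl : k ≤ l) {f : N → ℚ} (h : IsPolynomialOn E M k f) :
    IsPolynomialOn E M l f := by
  induction hkl with
  | refl => exact h
  | step _ ih => exact ih.succ

theorem add {k : ℕ} {f f' : N → ℚ} (h : IsPolynomialOn E M k f) (h' : IsPolynomialOn E M k f') :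
    IsPolynomialOn E M k (fun x => f x + f' x) := by
  induction k using Nat.strong_induction_on generalizing f f' with
  | _ k ih =>
    cases k with
    | zero =>
      rw [zero_iff] at h h' ⊢
      exact fun x hx => by rw [h x hx, h' x hx, add_zero]
    | succ k =>
      rw [succ_iff] at h h' ⊢
      exact fun i g hg hgi => (ih (k - i) (by omega) (h i g hg hgi) (h' i g hg hgi)).congr
        fun x hx => by ring

theorem translate (htop : E 0 = ⊤) {k : ℕ} {f : N → ℚ} (h : IsPolynomialOn E M k f) {g : N}
    (hg : g ∈ M) : IsPolynomialOn E M k (fun x => f (x * g)) := by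
  cases k with
  | zero => exact zero_iff.2 fun x hx => zero_iff.1 h _ (M.mul_mem hx hg)
  | succ k =>
    have h1 := succ_iff.1 h 0 g hg (htop ▸ mem_top g)
    exact (h.add (mono (by omega) h1)).congr fun x _ => by ring

/-- Conjugation by `u ∈ E w` moves `g ∈ E i` by a factor in `E (i + w + 1)`, so it changes `f` only
in degrees lower by `w + 1`. With `g' = u⁻¹ * g * u`, the difference along `g` splits into the same
expression for the difference of `f` along `g'` (induction) and a translate of the difference of `f`
along `g⁻¹ * g'`. If `k ≤ w`, then `f` is constant on `M`. -/
theorem conj_sub (htop : E 0 = ⊤) (hanti : Antitone E)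
    (hcomm : ∀ i j, ∀ a ∈ E i, ∀ b ∈ E j, ⁅a, b⁆ ∈ E (i + j + 1)) {w : ℕ} {u : N} (hu : u ∈ E w)
    (hM : M ≤ E w) (huM : ∀ m ∈ M, u⁻¹ * m * u ∈ M) {k : ℕ} {f : N → ℚ}
    (h : IsPolynomialOn E M k f) :
    IsPolynomialOn E M (k - (w + 1)) (fun x => f (u⁻¹ * x * u) - f x) := by
  induction k using Nat.strong_induction_on generalizing f with
  | _ k ih =>
    cases k with
    | zero =>
      rw [zero_iff] at h
      exact of_eq_zero (fun x hx => by rw [h x hx, h _ (huM x hx), sub_zero]) _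
    | succ k =>
      rcases le_or_gt k w with hkw | hkw
      · have h1 : ∀ x ∈ M, f x = f 1 := by
          intro x hx
          have h2 := succ_iff.1 h w x hx (hM hx)
          rw [Nat.sub_eq_zero_of_le hkw, zero_iff] at h2
          have h3 := h2 1 M.one_mem
          rw [one_mul] at h3
          exact sub_eq_zero.1 h3
        exact of_eq_zero (fun x hx => by rw [h1 x hx, h1 _ (huM x hx), sub_self]) _
      · obtain ⟨l, hl⟩ : ∃ l, k + 1 - (w + 1) = l + 1 := ⟨k - w - 1, by omega⟩
        rw [hl, succ_iff]
        intro i g hg hgi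
        have hg' : u⁻¹ * g * u ∈ M := huM g hg
        have hcm : g⁻¹ * (u⁻¹ * g * u) ∈ E (i + w + 1) := by
          have := hcomm i w g⁻¹ ((E i).inv_mem hgi) u⁻¹ ((E w).inv_mem hu)
          rw [commutatorElement_def] at this
          simpa [mul_assoc] using this
        have hg'i : u⁻¹ * g * u ∈ E i := by
          have := (E i).mul_mem hgi (hanti (by omega : i ≤ i + w + 1) hcm)
          simpa using this
        have h1 := ih (k - i) (by omega) (succ_iff.1 h i _ hg' hg'i)
        have h2 := (succ_iff.1 h (i + w + 1) _ (M.mul_mem (M.inv_mem hg) hg') hcm).translate htop hg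
        rw [show k - i - (w + 1) = l - i by omega] at h1
        rw [show k - (i + w + 1) = l - i by omega] at h2
        refine (h1.add h2).congr fun x _ => ?_
        simp only [mul_assoc, mul_inv_cancel_left]
        ring

/-- Here `κ` reads off the exponent of `u`, and `f` is extended so as not to depend on it. For `x =
u ^ a * m` and `g = u ^ j * m'` one has `x * g = u ^ (a + j) * ((u ^ j)⁻¹ * m * u ^ j * m')`, so a
difference of the extension is the extension of a function on `M`, to which induction applies. Its
degree is controlled by `conj_sub` if `i ≤ w`; if `i > w`, then `g ∈ M` and `j = 0`. -/
theorem extend (htop : E 0 = ⊤) (hanti : Antitone E)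
    (hcomm : ∀ i j, ∀ a ∈ E i, ∀ b ∈ E j, ⁅a, b⁆ ∈ E (i + j + 1)) {w : ℕ} {u : N} (hu : u ∈ E w)
    (hM : M ≤ E w) (hwM : E (w + 1) ≤ M) {M' : Subgroup N} {κ : N → ℤ}
    (hκ : ∀ j : ℤ, ∀ m ∈ M, κ (u ^ j * m) = j) (hM' : ∀ x ∈ M', u ^ (-κ x) * x ∈ M) {k : ℕ}
    {f : N → ℚ} (h : IsPolynomialOn E M k f) :
    IsPolynomialOn E M' k (fun x => f (u ^ (-κ x) * x)) := by
  have hconj : ∀ v ∈ E w, ∀ m ∈ M, v⁻¹ * m * v ∈ M := by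
    intro v hv m hm
    have h1 := hcomm w w v⁻¹ ((E w).inv_mem hv) m (hM hm)
    have h2 := M.mul_mem (hwM (hanti (by omega : w + 1 ≤ w + w + 1) h1)) hm
    rw [commutatorElement_def] at h2
    simpa [mul_assoc] using h2
  induction k using Nat.strong_induction_on generalizing f with
  | _ k ih =>
    cases k with
    | zero => exact zero_iff.2 fun x hx => zero_iff.1 h _ (hM' x hx)
    | succ k =>
      rw [succ_iff]
      intro i g hg hgi
      set j := κ g with hj
      set m' := u ^ (-j) * g with hm'
      have hm'M : m' ∈ M := hM' g hg
      have hv : u ^ j ∈ E w := (E w).zpow_mem hu j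
      have hpol : IsPolynomialOn E M (k - i)
          (fun x => f ((u ^ j)⁻¹ * x * u ^ j * m') - f x) := by
        rcases le_or_gt i w with hiw | hiw
        · have h1 := (h.translate htop hm'M).conj_sub htop hanti hcomm hv hM (hconj _ hv)
          have h2 := succ_iff.1 h i m' hm'M (hanti hiw (hM hm'M))
          exact ((h1.mono (by omega)).add h2).congr fun x _ => by ring
        · have hgM : g ∈ M := hwM (hanti hiw hgi)
          have hj0 : j = 0 := by
            have := hκ 0 g hgM
            rwa [zpow_zero, one_mul] at this
          have hmg : m' = g := by rw [hm', hj0]; simp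
          rw [hj0, hmg]
          simpa using succ_iff.1 h i g hgM hgi
      refine (ih (k - i) (by omega) hpol).congr fun x hx => ?_
      have hm := hM' x hx
      set m := u ^ (-κ x) * x with hmdef
      have h1 : x * g = u ^ (κ x + j) * ((u ^ j)⁻¹ * m * u ^ j * m') := by
        rw [hmdef, hm', zpow_add]; group
      have h2 : κ (x * g) = κ x + j := by
        rw [h1]
        exact hκ _ _ (M.mul_mem (hconj _ hv m hm) hm'M)
      have h3 : u ^ (-κ (x * g)) * (x * g) = (u ^ j)⁻¹ * m * u ^ j * m' := by
        rw [h2]; nth_rewrite 1 [h1]; group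
      simp only [h3]

theorem of_eq_const {f : N → ℚ} {q : ℚ} (hf : ∀ x ∈ M, f x = q) (k : ℕ) :
    IsPolynomialOn E M (k + 1) f :=
  succ_iff.2 fun _ g hg _ => of_eq_zero (fun x hx => by
    rw [hf x hx, hf _ (M.mul_mem hx hg), sub_self]) _

end IsPolynomialOn

theorem exists_hom_free_of_isolated {K : Type*} [Group K] [Group.FG K] (L : Subgroup K) [L.Normal]
    (hcomm : ∀ a b : K, ⁅a, b⁆ ∈ L) (hiso : ∀ (n : ℕ) (x : K), 0 < n → x ^ n ∈ L → x ∈ L) :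
    ∃ (r : ℕ) (Λ : K →* Multiplicative (Fin r → ℤ)), Λ.ker = L ∧ Function.Surjective Λ := by
  let : CommGroup (K ⧸ L) :=
    { (inferInstance : Group (K ⧸ L)) with
      mul_comm := by
        intro a b
        obtain ⟨a, rfl⟩ := QuotientGroup.mk_surjective a
        obtain ⟨b, rfl⟩ := QuotientGroup.mk_surjective b
        refine QuotientGroup.eq.2 ?_
        have := hcomm b⁻¹ a⁻¹
        rw [commutatorElement_def] at this
        simpa [mul_assoc] using this }
  have : AddGroup.FG (Additive (K ⧸ L)) := GroupFG.iff_add_fg.1 inferInstance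
  have : Module.Finite ℤ (Additive (K ⧸ L)) := Module.Finite.iff_addGroup_fg.2 inferInstance
  have : IsMulTorsionFree (K ⧸ L) := by
    refine ⟨fun n hn a b hab => ?_⟩
    obtain ⟨a, rfl⟩ := QuotientGroup.mk_surjective a
    obtain ⟨b, rfl⟩ := QuotientGroup.mk_surjective b
    refine QuotientGroup.eq.2 (hiso n _ (Nat.pos_of_ne_zero hn) ?_)
    rw [← QuotientGroup.eq_one_iff, QuotientGroup.mk_pow, QuotientGroup.mk_mul,
      QuotientGroup.mk_inv, mul_pow, inv_pow]
    exact inv_mul_eq_one.2 hab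
  have : Module.Free ℤ (Additive (K ⧸ L)) := inferInstance
  let b := Module.finBasis ℤ (Additive (K ⧸ L))
  let e : Additive (K ⧸ L) ≃+ (Fin _ → ℤ) := b.equivFun.toAddEquiv
  let e' : K ⧸ L →* Multiplicative (Fin _ → ℤ) := AddMonoidHom.toMultiplicativeRight e.toAddMonoidHom
  have he : Function.Bijective e' := e.bijective
  refine ⟨_, e'.comp (QuotientGroup.mk' L), ?_, he.2.comp (QuotientGroup.mk'_surjective L)⟩
  ext x
  rw [MonoidHom.mem_ker, MonoidHom.comp_apply, map_eq_one_iff e' he.1, QuotientGroup.mk'_apply,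
    QuotientGroup.eq_one_iff]

end Subgroup

namespace Subgroup

open scoped commutatorElement

/-- The layer is crossed one coordinate at a time. `M s` consists of the elements of `E w` whose
coordinates from index `s` on vanish, so `M 0 = E (w + 1)` and `M r = E w`; a lift `u` of the basis
vector number `s` leads from `M s` to `M (s + 1)`. -/
theorem IsPolynomialOn.exists_extend_layer {N : Type*} [Group N] {E : ℕ → Subgroup N}
    (htop : E 0 = ⊤) (hanti : Antitone E)
    (hcomm : ∀ i j, ∀ a ∈ E i, ∀ b ∈ E j, ⁅a, b⁆ ∈ E (i + j + 1)) {w r : ℕ}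
    {Λ : E w →* Multiplicative (Fin r → ℤ)} (hker : Λ.ker = (E (w + 1)).subgroupOf (E w))
    (hsurj : Function.Surjective Λ) {k : ℕ} {f : N → ℚ} (h : IsPolynomialOn E (E (w + 1)) k f) :
    ∃ f', IsPolynomialOn E (E w) k f' ∧ ∀ x ∈ E (w + 1), f' x = f x := by
  classical
  let M : ℕ → Subgroup N := fun s =>
    { carrier := {x | ∃ hx : x ∈ E w, ∀ t : Fin r, s ≤ t → (Λ ⟨x, hx⟩).toAdd t = 0}
      one_mem' := ⟨(E w).one_mem, fun t _ => by
        rw [show (⟨1, (E w).one_mem⟩ : E w) = 1 from rfl, map_one]; rfl⟩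
      mul_mem' := by
        rintro a b ⟨ha, ha'⟩ ⟨hb, hb'⟩
        refine ⟨(E w).mul_mem ha hb, fun t ht => ?_⟩
        rw [show (⟨a * b, (E w).mul_mem ha hb⟩ : E w) = ⟨a, ha⟩ * ⟨b, hb⟩ from rfl, map_mul,
          toAdd_mul, Pi.add_apply, ha' t ht, hb' t ht, add_zero]
      inv_mem' := by
        rintro a ⟨ha, ha'⟩
        refine ⟨(E w).inv_mem ha, fun t ht => ?_⟩
        rw [show (⟨a⁻¹, (E w).inv_mem ha⟩ : E w) = ⟨a, ha⟩⁻¹ from rfl, map_inv,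
          toAdd_inv, Pi.neg_apply, ha' t ht, neg_zero] }
  have hMw : ∀ s, M s ≤ E w := fun s x hx => hx.1
  have hwM : ∀ s, E (w + 1) ≤ M s := fun s x hx => by
    have hxw := hanti (Nat.le_succ w) hx
    refine ⟨hxw, fun t _ => ?_⟩
    have h1 : (⟨x, hxw⟩ : E w) ∈ Λ.ker := by rw [hker]; exact hx
    rw [MonoidHom.mem_ker.1 h1]; rfl
  have hM0 : M 0 = E (w + 1) := by
    refine le_antisymm ?_ (hwM 0)
    rintro x ⟨hxw, hx⟩
    have h1 : (⟨x, hxw⟩ : E w) ∈ Λ.ker := by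
      rw [MonoidHom.mem_ker]
      apply Multiplicative.toAdd.injective
      funext t
      exact hx t (Nat.zero_le _)
    rw [hker] at h1
    exact h1
  have hMr : M r = E w := by
    refine le_antisymm (hMw r) fun x hx => ⟨hx, fun t ht => ?_⟩
    exact absurd t.2 (by omega)
  have key : ∀ s, s ≤ r → ∃ f', IsPolynomialOn E (M s) k f' ∧ ∀ x ∈ E (w + 1), f' x = f x := by
    intro s
    induction s with
    | zero => exact fun _ => ⟨f, by rw [hM0]; exact h, fun _ _ => rfl⟩
    | succ s ih =>
      intro hs
      obtain ⟨f', hf', hff⟩ := ih (by omega)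
      obtain ⟨⟨u, hu⟩, huΛ⟩ := hsurj (Multiplicative.ofAdd (Pi.single (⟨s, hs⟩ : Fin r) 1))
      let κ : N → ℤ := fun x => if hx : x ∈ E w then (Λ ⟨x, hx⟩).toAdd ⟨s, hs⟩ else 0
      have hκdef : ∀ x (hx : x ∈ E w), κ x = (Λ ⟨x, hx⟩).toAdd ⟨s, hs⟩ := fun x hx => dif_pos hx
      have hΛ : ∀ (j : ℤ) (m : N) (hm : m ∈ E w) (t : Fin r),
          (Λ ⟨u ^ j * m, (E w).mul_mem ((E w).zpow_mem hu j) hm⟩).toAdd t =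
            j * (Pi.single (⟨s, hs⟩ : Fin r) (1 : ℤ) : Fin r → ℤ) t + (Λ ⟨m, hm⟩).toAdd t := by
        intro j m hm t
        rw [show (⟨u ^ j * m, (E w).mul_mem ((E w).zpow_mem hu j) hm⟩ : E w) =
          ⟨u, hu⟩ ^ j * ⟨m, hm⟩ from rfl, map_mul, map_zpow, huΛ]
        simp
      refine ⟨_, hf'.extend htop hanti hcomm hu (hMw s) (hwM s) (κ := κ) ?_ ?_, ?_⟩
      · rintro j m ⟨hm, hm'⟩
        rw [hκdef _ ((E w).mul_mem ((E w).zpow_mem hu j) hm), hΛ j m hm, hm' _ le_rfl]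
        simp
      · rintro x ⟨hx, hx'⟩
        refine ⟨(E w).mul_mem ((E w).zpow_mem hu _) hx, fun t ht => ?_⟩
        rw [hΛ _ x hx, hκdef x hx]
        rcases eq_or_ne t ⟨s, hs⟩ with rfl | hne
        · simp
        · have hlt : s + 1 ≤ (t : ℕ) := by
            have : (t : ℕ) ≠ s := fun h' => hne (Fin.ext h')
            omega
          rw [Pi.single_eq_of_ne hne, hx' t hlt]; simp
      · intro x hx
        have hxM := hwM s hx
        have h0 : κ x = 0 := by rw [hκdef x (hMw s hxM)]; exact hxM.2 _ le_rfl
        simp only [h0, neg_zero, zpow_zero, one_mul]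
        exact hff x hx
  obtain ⟨f', hf', hff⟩ := key r le_rfl
  exact ⟨f', hMr ▸ hf', hff⟩

/-- A filtration of `N` with `E 0 = N`, compatible with commutators and with finitely generated
free abelian layers, has enough polynomial functions to separate points. -/
theorem exists_isPolynomialOn_ne {N : Type*} [Group N] {E : ℕ → Subgroup N}
    (htop : E 0 = ⊤) (hanti : Antitone E)
    (hcomm : ∀ i j, ∀ a ∈ E i, ∀ b ∈ E j, ⁅a, b⁆ ∈ E (i + j + 1))
    (hlayer : ∀ w, ∃ (r : ℕ) (Λ : E w →* Multiplicative (Fin r → ℤ)),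
      Λ.ker = (E (w + 1)).subgroupOf (E w) ∧ Function.Surjective Λ) {c : ℕ} (hbot : E c = ⊥)
    {z : N} (hz : z ≠ 1) : ∃ f, IsPolynomialOn E ⊤ (c + 1) f ∧ f z ≠ f 1 := by
  classical
  -- Take the last `i` with `z ∈ E i`. Some coordinate of the layer `E i / E (i + 1)` is nonzero at
  -- `z`; as a homomorphism on `E i` killing `E (i + 1)` it is polynomial there of degree at most `i
  -- + 1 ≤ c`, and it extends outwards through the layers to all of `N`.
  have hex : ∃ i, z ∉ E i := ⟨c, by rw [hbot, mem_bot]; exact hz⟩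
  obtain ⟨i, hi⟩ : ∃ i, Nat.find hex = i + 1 := by
    refine Nat.exists_eq_succ_of_ne_zero fun h0 => ?_
    have := Nat.find_spec hex
    rw [h0, htop] at this
    exact this (mem_top z)
  have hzi : z ∈ E i := by
    by_contra hcon
    exact absurd (Nat.find_min' hex hcon) (by omega)
  have hzi' : z ∉ E (i + 1) := hi ▸ Nat.find_spec hex
  have hic : i + 1 ≤ c := hi ▸ Nat.find_min' hex (by rw [hbot, mem_bot]; exact hz)
  have hup : ∀ (k : ℕ) (f : N → ℚ) (w : ℕ), IsPolynomialOn E (E w) k f →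
      ∃ f', IsPolynomialOn E ⊤ k f' ∧ ∀ x ∈ E w, f' x = f x := by
    intro k f w
    induction w generalizing f with
    | zero => exact fun h => ⟨f, htop ▸ h, fun _ _ => rfl⟩
    | succ w ih =>
      intro h
      obtain ⟨r, Λ, hker, hsurj⟩ := hlayer w
      obtain ⟨f₁, hf₁, h₁⟩ := h.exists_extend_layer htop hanti hcomm hker hsurj
      obtain ⟨f₂, hf₂, h₂⟩ := ih f₁ hf₁
      exact ⟨f₂, hf₂, fun x hx => (h₂ x (hanti (Nat.le_succ w) hx)).trans (h₁ x hx)⟩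
  obtain ⟨r, Λ, hker, -⟩ := hlayer i
  obtain ⟨t, ht⟩ : ∃ t, (Λ ⟨z, hzi⟩).toAdd t ≠ 0 := by
    by_contra! hcon
    apply hzi'
    have h1 : (⟨z, hzi⟩ : E i) ∈ Λ.ker := by
      rw [MonoidHom.mem_ker]
      apply Multiplicative.toAdd.injective
      funext t
      exact hcon t
    rw [hker] at h1
    exact h1
  let f : N → ℚ := fun x => if hx : x ∈ E i then ((Λ ⟨x, hx⟩).toAdd t : ℚ) else 0
  have hfdef : ∀ x (hx : x ∈ E i), f x = ((Λ ⟨x, hx⟩).toAdd t : ℚ) := fun x hx => dif_pos hx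
  have hfmul : ∀ x ∈ E i, ∀ g ∈ E i, f (x * g) = f x + f g := by
    intro x hx g hg
    rw [hfdef x hx, hfdef g hg, hfdef _ ((E i).mul_mem hx hg),
      show (⟨x * g, (E i).mul_mem hx hg⟩ : E i) = ⟨x, hx⟩ * ⟨g, hg⟩ from rfl, map_mul]
    simp
  have hf : IsPolynomialOn E (E i) (c + 1) f := by
    refine IsPolynomialOn.mono (by omega : i + 1 + 1 ≤ c + 1) ?_
    rw [IsPolynomialOn.succ_iff]
    intro j g hg hgj
    rcases le_or_gt j i with hji | hji
    · rw [show i + 1 - j = i - j + 1 by omega]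
      exact IsPolynomialOn.of_eq_const (q := f g) (fun x hx => by rw [hfmul x hx g hg]; ring) _
    · refine IsPolynomialOn.of_eq_zero (fun x hx => ?_) _
      have h1 : (⟨g, hg⟩ : E i) ∈ Λ.ker := by
        rw [hker]; exact hanti (by omega : i + 1 ≤ j) hgj
      rw [hfmul x hx g hg, hfdef g hg, MonoidHom.mem_ker.1 h1]
      simp
  obtain ⟨f', hf', hff⟩ := hup _ f i hf
  refine ⟨f', hf', ?_⟩
  rw [hff z hzi, hff 1 (E i).one_mem, hfdef z hzi, hfdef 1 (E i).one_mem,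
    show (⟨1, (E i).one_mem⟩ : E i) = 1 from rfl, map_one]
  simpa using ht

end Subgroup

/-! ### Faithfulness of the truncated group algebra. -/

namespace Malcev

open Subgroup
open scoped commutatorElement

/-- For `y ∈ I ^ k`, induction applied to `x ↦ f (x * g) - f x` gives `l (y * g) = l y` for every
group element `g`. So `z ↦ l (y * z)` is `l y` times the augmentation and vanishes on `I`. -/
theorem linearCombination_eq_zero_of_mem_augIdeal_pow {N : Type*} [Group N] {E : ℕ → Subgroup N}
    (htop : E 0 = ⊤) {k : ℕ} {f : N → ℚ} (hf : IsPolynomialOn E ⊤ k f) {l : MonoidAlgebra ℚ N →ₗ[ℚ] ℚ}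
    (hl : ∀ g, l (MonoidAlgebra.of ℚ N g) = f g) {x : MonoidAlgebra ℚ N}
    (hx : x ∈ augIdeal N ^ k) : l x = 0 := by
  induction k generalizing f l x with
  | zero =>
    have : l = 0 := by
      ext g
      simpa using (hl g).trans (IsPolynomialOn.zero_iff.1 hf g (mem_top g))
    rw [this, LinearMap.zero_apply]
  | succ k ih =>
    rw [Submodule.pow_succ] at hx
    refine Submodule.mul_induction_on hx ?_ ?_
    · intro y hy z hz
      have h1 : l.comp (LinearMap.mulLeft ℚ y) = (l y) • (augmentation N).toLinearMap := by
        ext g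
        have h2 := ih (f := fun x => f (x * g) - f x)
          (l := l.comp (LinearMap.mulRight ℚ (MonoidAlgebra.of ℚ N g)) - l)
          (IsPolynomialOn.succ_iff.1 hf 0 g (mem_top g) (htop ▸ mem_top g))
          (fun x => by
            rw [LinearMap.sub_apply, LinearMap.comp_apply, LinearMap.mulRight_apply, ← map_mul, hl,
              hl]) hy
        rw [LinearMap.sub_apply, sub_eq_zero] at h2
        simpa [augmentation] using h2
      have h2 := LinearMap.congr_fun h1 z
      have h3 : augmentation N z = 0 := hz
      simpa [h3] using h2
    · intro y z hy hz
      rw [map_add, hy, hz, add_zero]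

/-- The filtration of a torsion-free nilpotent group by the isolators of the terms of its lower
central series. -/
def isolatedSeries (N : Type u) [Group N] [Group.IsNilpotent N] (i : ℕ) : Subgroup N :=
  isolator ((⊤ : Subgroup N).lowerCentralSeries i)

section isolatedSeries

variable {N : Type u} [Group N] [Group.IsNilpotent N]

theorem isolatedSeries_zero : isolatedSeries N 0 = ⊤ :=
  eq_top_iff.2 fun _ _ => ⟨1, one_pos, mem_top _⟩

theorem isolatedSeries_antitone : Antitone (isolatedSeries N) := by
  rintro i j hij x ⟨n, hn, hx⟩
  exact ⟨n, hn, Subgroup.lowerCentralSeries_antitone _ hij hx⟩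

instance (i : ℕ) : (isolatedSeries N i).Normal := by
  refine ⟨fun x ⟨n, hn, hx⟩ g => ⟨n, hn, ?_⟩⟩
  rw [conj_pow]
  exact Subgroup.Normal.conj_mem inferInstance _ hx g

theorem mem_isolatedSeries_of_pow_mem {i n : ℕ} (hn : 0 < n) {x : N}
    (hx : x ^ n ∈ isolatedSeries N i) : x ∈ isolatedSeries N i := by
  obtain ⟨m, hm, h⟩ := hx
  exact ⟨n * m, Nat.mul_pos hn hm, by rwa [pow_mul]⟩

theorem commutator_mem_isolatedSeries {i j : ℕ} {a b : N} (ha : a ∈ isolatedSeries N i)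
    (hb : b ∈ isolatedSeries N j) : ⁅a, b⁆ ∈ isolatedSeries N (i + j + 1) := by
  obtain ⟨m, hm, ha⟩ := ha
  obtain ⟨n, hn, hb⟩ := hb
  set L := isolatedSeries N (i + j + 1) with hL
  -- Powers of `a` and `b` commute modulo `L`; since the quotient by an isolator is torsion-free,
  -- `a` and `b` themselves commute there.
  have htf : ∀ g : N ⧸ L, IsOfFinOrder g → g = 1 := by
    intro g hg
    obtain ⟨g, rfl⟩ := QuotientGroup.mk_surjective g
    obtain ⟨m, hm, hgm⟩ := isOfFinOrder_iff_pow_eq_one.1 hg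
    rw [← QuotientGroup.mk_pow, QuotientGroup.eq_one_iff] at hgm
    exact (QuotientGroup.eq_one_iff _).2 (mem_isolatedSeries_of_pow_mem hm hgm)
  have h1 : ⁅a ^ m, b ^ n⁆ ∈ L :=
    ⟨1, one_pos, by
      rw [pow_one]
      exact commutator_lowerCentralSeries_le i j (commutator_mem_commutator ha hb)⟩
  have h2 : Commute ((QuotientGroup.mk' L a) ^ m) ((QuotientGroup.mk' L b) ^ n) := by
    rw [← commutatorElement_eq_one_iff_commute, ← map_pow, ← map_pow, ← map_commutatorElement]
    exact (QuotientGroup.eq_one_iff _).2 h1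
  have h3 := commute_of_commute_pow htf hn (commute_of_commute_pow htf hm h2).symm
  rw [← commutatorElement_eq_one_iff_commute, ← map_commutatorElement] at h3
  have h4 := (QuotientGroup.eq_one_iff _).1 h3
  rw [← commutatorElement_inv]
  exact L.inv_mem h4

end isolatedSeries

/-- A finitely generated torsion-free nilpotent group embeds into its truncated group algebra. -/
theorem eq_one_of_of_sub_one_mem {N : Type u} [Group N] (hN : IsFGroup N) {g : N}
    (hg : MonoidAlgebra.of ℚ N g - 1 ∈ augIdeal N ^ (Group.nilpotencyClass N + 1)) : g = 1 := by
  have := hN.nilpotent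
  have := hN.fg
  by_contra hne
  have hbot : isolatedSeries N (Group.nilpotencyClass N) = ⊥ := by
    rw [eq_bot_iff]
    rintro x ⟨n, hn, hx⟩
    rw [Subgroup.lowerCentralSeries_nilpotencyClass, mem_bot] at hx
    exact hN.torsionFree x (isOfFinOrder_iff_pow_eq_one.2 ⟨n, hn, hx⟩)
  -- A polynomial function of degree at most `c` with `f g ≠ f 1`: its linear extension kills `I ^
  -- (c + 1)` but not `g - 1`.
  obtain ⟨f, hf, hfg⟩ := exists_isPolynomialOn_ne (E := isolatedSeries N) isolatedSeries_zero
    isolatedSeries_antitone (fun i j a ha b hb => commutator_mem_isolatedSeries ha hb)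
    (fun w => by
      have : Group.FG (isolatedSeries N w) :=
        (Group.fg_iff_subgroup_fg _).2 (fg_of_isNilpotent _)
      refine exists_hom_free_of_isolated _ ?_ ?_
      · intro a b
        exact isolatedSeries_antitone (by omega : w + 1 ≤ w + w + 1)
          (commutator_mem_isolatedSeries a.2 b.2)
      · intro n x hn hx
        exact mem_isolatedSeries_of_pow_mem hn hx) hbot hne
  have h := linearCombination_eq_zero_of_mem_augIdeal_pow isolatedSeries_zero hf
    (l := (Finsupp.linearCombination ℚ f).comp (MonoidAlgebra.coeffLinearEquiv ℚ).toLinearMap)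
    (fun g => by simp) hg
  apply hfg
  simpa [MonoidAlgebra.one_def, sub_eq_zero] using h

end Malcev

/-! ### Finitely generated abelian groups modulo an integer. -/

theorem Submodule.FG.exists_nsmul_mem {M : Type*} [AddCommGroup M] {S : Submodule ℤ M} (hS : S.FG)
    (T : Submodule ℤ M) (h : ∀ s ∈ S, ∃ n : ℕ, 0 < n ∧ n • s ∈ T) :
    ∃ n : ℕ, 0 < n ∧ ∀ s ∈ S, n • s ∈ T := by
  induction S, hS using Submodule.fg_induction with
  | singleton x =>
    obtain ⟨n, hn, hx⟩ := h x (Submodule.mem_span_singleton_self x)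
    refine ⟨n, hn, fun s hs => ?_⟩
    obtain ⟨a, rfl⟩ := Submodule.mem_span_singleton.1 hs
    rw [smul_comm]
    exact T.smul_mem a hx
  | sup S₁ S₂ _ _ ih₁ ih₂ =>
    obtain ⟨m, hm, h₁⟩ := ih₁ fun s hs => h s (Submodule.mem_sup_left hs)
    obtain ⟨n, hn, h₂⟩ := ih₂ fun s hs => h s (Submodule.mem_sup_right hs)
    refine ⟨m * n, Nat.mul_pos hm hn, fun s hs => ?_⟩
    obtain ⟨x, hx, y, hy, rfl⟩ := Submodule.mem_sup.1 hs
    rw [smul_add]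
    refine T.add_mem ?_ ?_
    · rw [mul_comm, mul_smul]; exact T.smul_of_tower_mem n (h₁ x hx)
    · rw [mul_smul]; exact T.smul_of_tower_mem m (h₂ y hy)

/-- An endomorphism of a finitely generated abelian group which is surjective modulo `q` has a
power, depending only on `q`, which is the identity modulo `q`. -/
theorem exists_iterate_sub_self_eq_nsmul {M : Type*} [AddCommGroup M] [Module.Finite ℤ M] {q : ℕ}
    (hq : 0 < q) : ∃ k : ℕ, 0 < k ∧ ∀ f : M →ₗ[ℤ] M, (∀ x, ∃ y z, x = f y + q • z) →
      ∀ x, ∃ z, f^[k] x - x = q • z := by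
  classical
  set R : Submodule ℤ M := LinearMap.range (LinearMap.lsmul ℤ M q) with hR
  have hmem : ∀ x, x ∈ R ↔ ∃ z, x = q • z := fun x => by
    rw [hR, LinearMap.mem_range]
    refine exists_congr fun z => ?_
    rw [LinearMap.lsmul_apply, natCast_zsmul, eq_comm]
  have htors : Module.IsTorsion ℤ (M ⧸ R) := by
    rintro ⟨x⟩
    refine ⟨⟨q, mem_nonZeroDivisors_of_ne_zero (by exact_mod_cast hq.ne')⟩, ?_⟩
    refine (Submodule.Quotient.mk_eq_zero R).2 ((hmem _).2 ⟨x, ?_⟩)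
    exact natCast_zsmul x q
  have hfin : Finite (M ⧸ R) := Module.finite_of_fg_torsion _ htors
  have := Fintype.ofFinite (M ⧸ R)
  -- The order of the full permutation group of `M / qM` serves for all `f` at once. This uniformity
  -- is essential in `exists_mem_of_map_sub_one_eq_nsmul`, where the endomorphism varies with the
  -- group element.
  refine ⟨Fintype.card (Equiv.Perm (M ⧸ R)), Fintype.card_pos, fun f hf x => ?_⟩
  have hle : R ≤ R.comap f := fun x hx => by
    obtain ⟨z, rfl⟩ := (hmem x).1 hx
    exact (hmem _).2 ⟨f z, map_nsmul f q z⟩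
  set F : M ⧸ R →ₗ[ℤ] M ⧸ R := R.mapQ R f hle with hF
  have hsurj : Function.Surjective F := by
    rintro ⟨x⟩
    obtain ⟨y, z, rfl⟩ := hf x
    refine ⟨Submodule.Quotient.mk y, ?_⟩
    refine (Submodule.Quotient.eq R).2 ((hmem _).2 ⟨-z, ?_⟩)
    rw [smul_neg]; abel
  let e : Equiv.Perm (M ⧸ R) :=
    Equiv.ofBijective F ⟨Finite.injective_iff_surjective.2 hsurj, hsurj⟩
  have h1 : ∀ k : ℕ, ∀ x : M, (e ^ k) (Submodule.Quotient.mk x) = Submodule.Quotient.mk (f^[k] x) := by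
    intro k
    induction k with
    | zero => exact fun x => rfl
    | succ k ih =>
      intro x
      rw [pow_succ, Equiv.Perm.mul_apply, Function.iterate_succ_apply, ← ih (f x)]
      rfl
  have h2 := h1 (Fintype.card (Equiv.Perm (M ⧸ R))) x
  rw [pow_card_eq_one, Equiv.Perm.one_apply] at h2
  exact (hmem _).1 ((Submodule.Quotient.eq R).1 h2.symm)

/-! ### Unipotent units: nilpotent, torsion-free and radicable. -/

section NilpotentIdeal

variable {A : Type v} [Ring A]

theorem Ideal.mul_mem_pow_add (J : Ideal A) [J.IsTwoSided] {i j : ℕ} {a b : A} (ha : a ∈ J ^ i)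
    (hb : b ∈ J ^ j) : a * b ∈ J ^ (i + j) := by
  rcases Nat.eq_zero_or_pos j with rfl | hj
  · exact (J ^ i).mul_mem_right b ha
  · rw [Submodule.pow_add _ hj.ne']
    exact Ideal.mul_mem_mul ha hb

/-- The subring generated by finitely many elements of a nilpotent ideal is finitely generated as
an additive group. -/
theorem Algebra.fg_adjoin_int_of_isNilpotent (J : Ideal A) [J.IsTwoSided] {m : ℕ} (hJ : J ^ m = ⊥)
    (S : Submodule ℤ A) (hS : S.FG) (hSJ : ∀ x ∈ S, x ∈ J) :
    (Subalgebra.toSubmodule (Algebra.adjoin ℤ (S : Set A))).FG := by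
  have hpow : ∀ j, ∀ x ∈ S ^ j, x ∈ J ^ j := by
    intro j
    induction j with
    | zero => intro x _; rw [Submodule.pow_zero, Ideal.one_eq_top]; trivial
    | succ j ih =>
      intro x hx
      rw [pow_succ] at hx
      refine Submodule.mul_induction_on hx (fun a ha b hb => ?_) fun a b => (J ^ (j + 1)).add_mem
      exact J.mul_mem_pow_add (ih a ha) (by rw [Submodule.pow_one]; exact hSJ b hb)
  have hSm : S ^ m = ⊥ := by
    rw [eq_bot_iff]
    intro x hx
    have := hpow m x hx
    rwa [hJ] at this
  -- `P` is the sum of the powers of `S`, only finitely many of which are nonzero because `S ^ m =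
  -- ⊥`; it is stable under multiplication by the subring.
  set P : Submodule ℤ A := ⨆ j : ℕ, S ^ j with hP
  have hPfg : P.FG := by
    have h1 : P = ⨆ j : Fin (m + 1), S ^ (j : ℕ) := by
      refine le_antisymm (iSup_le fun j => ?_) (iSup_le fun j => le_iSup (fun j => S ^ j) _)
      rcases lt_or_ge j m with hj | hj
      · exact le_iSup (fun j : Fin (m + 1) => S ^ (j : ℕ)) ⟨j, by omega⟩
      · obtain ⟨t, rfl⟩ := Nat.exists_eq_add_of_le hj
        rw [pow_add, hSm, Submodule.bot_mul]
        exact bot_le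
    rw [h1]
    exact Submodule.fg_iSup _ fun j => hS.pow _
  have hle : Subalgebra.toSubmodule (Algebra.adjoin ℤ (S : Set A)) ≤ P := by
    intro x hx
    suffices h : ∀ p ∈ P, x * p ∈ P by
      have h1 : (1 : A) ∈ P :=
        (le_iSup (fun j : ℕ => S ^ j) 0) (by
          simp only [pow_zero]; exact Submodule.one_le.1 le_rfl)
      simpa using h 1 h1
    have hx' : x ∈ Algebra.adjoin ℤ (S : Set A) := hx
    induction hx' using Algebra.adjoin_induction with
    | mem x hxS =>
      intro p hp
      have h1 : S * P ≤ P := by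
        rw [hP, Submodule.mul_iSup]
        exact iSup_le fun j => by
          rw [← pow_succ']; exact le_iSup (fun j : ℕ => S ^ j) (j + 1)
      exact h1 (Submodule.mul_mem_mul hxS hp)
    | algebraMap r =>
      intro p hp
      rw [← Algebra.smul_def]
      exact P.smul_mem r hp
    | add x y hx1 hy1 hx2 hy2 =>
      intro p hp
      rw [add_mul]
      exact P.add_mem (hx2 hx1 p hp) (hy2 hy1 p hp)
    | mul x y hx1 hy1 hx2 hy2 =>
      intro p hp
      rw [mul_assoc]
      exact hx2 hx1 _ (hy2 hy1 p hp)
  exact hPfg.of_le hle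

/-- The group of units congruent to `1` modulo the ideal `J`. -/
def unipotentUnits (J : Ideal A) [J.IsTwoSided] : Subgroup Aˣ where
  carrier := {u | (u : A) - 1 ∈ J}
  one_mem' := by simp
  mul_mem' := by
    intro u v hu hv
    have : ((u * v : Aˣ) : A) - 1 = ((u : A) - 1) * v + ((v : A) - 1) := by
      rw [Units.val_mul]; noncomm_ring
    rw [Set.mem_ofPred_eq, this]
    exact J.add_mem (J.mul_mem_right _ hu) hv
  inv_mem' := by
    intro u hu
    have : ((u⁻¹ : Aˣ) : A) - 1 = -((u⁻¹ : Aˣ) : A) * ((u : A) - 1) := by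
      rw [mul_sub, neg_mul, Units.inv_mul]; noncomm_ring
    rw [Set.mem_ofPred_eq, this]
    exact J.mul_mem_left _ hu

theorem mem_unipotentUnits {J : Ideal A} [J.IsTwoSided] {u : Aˣ} :
    u ∈ unipotentUnits J ↔ (u : A) - 1 ∈ J := Iff.rfl

/-- The subgroups `1 + J ^ (k + 1)` form a descending central series: with `a = u - 1` and `b = v -
1`, the commutator minus `1` is `(a * b - b * a) * u⁻¹ * v⁻¹`. -/
theorem isNilpotent_unipotentUnits (J : Ideal A) [J.IsTwoSided] {m : ℕ} (hJ : J ^ m = ⊥) :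
    Group.IsNilpotent (unipotentUnits J) := by
  rw [Subgroup.nilpotent_iff_finite_descending_central_series]
  refine ⟨m, fun k => (unipotentUnits (J ^ (k + 1))).subgroupOf (unipotentUnits J), ⟨?_, ?_⟩, ?_⟩
  · simp only [zero_add, Submodule.pow_one]
    exact Subgroup.subgroupOf_self _
  · rintro ⟨u, hu⟩ k hx ⟨v, hv⟩
    rw [Subgroup.mem_subgroupOf, mem_unipotentUnits] at hx ⊢
    have h1 : ((u * v * u⁻¹ * v⁻¹ : Aˣ) : A) - 1 =
        (((u : A) - 1) * ((v : A) - 1) - ((v : A) - 1) * ((u : A) - 1)) *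
          (((u⁻¹ : Aˣ) : A) * ((v⁻¹ : Aˣ) : A)) := by
      have h2 : ((u : A) - 1) * ((v : A) - 1) - ((v : A) - 1) * ((u : A) - 1) =
        (u : A) * v - v * u := by noncomm_ring
      rw [h2, sub_mul, mul_assoc (v : A) u, Units.mul_inv_cancel_left, Units.mul_inv]
      simp [mul_assoc]
    change ((u * v * u⁻¹ * v⁻¹ : Aˣ) : A) - 1 ∈ _
    rw [h1]
    refine (J ^ (k + 1 + 1)).mul_mem_right _ ((J ^ (k + 1 + 1)).sub_mem ?_ ?_)
    · exact J.mul_mem_pow_add hx (by rw [Submodule.pow_one]; exact hv)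
    · rw [add_comm (k + 1)]
      exact J.mul_mem_pow_add (by rw [Submodule.pow_one]; exact hv) hx
  · rw [eq_bot_iff]
    rintro ⟨u, hu⟩ hx
    rw [Subgroup.mem_subgroupOf, mem_unipotentUnits] at hx
    have h1 := Ideal.pow_le_pow_right (Nat.le_succ m) hx
    rw [hJ, Ideal.mem_bot, sub_eq_zero] at h1
    exact Subgroup.mem_bot.2 (Subtype.ext (Units.ext h1))

theorem Ideal.isNilpotent_of_mem {J : Ideal A} {m : ℕ} (hJ : J ^ m = ⊥) {a : A} (ha : a ∈ J) :
    IsNilpotent a :=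
  ⟨m, by have := Ideal.pow_mem_pow ha m; rwa [hJ, Ideal.mem_bot] at this⟩

variable [Algebra ℚ A]

/-- In `(u - 1) * (1 + u + ⋯ + u ^ (n - 1)) = 0` the second factor is `n` plus an element of the
nilpotent ideal `J`, hence a unit over `ℚ`. -/
theorem eq_one_of_isOfFinOrder_unipotentUnits (J : Ideal A) [J.IsTwoSided] {m : ℕ}
    (hJ : J ^ m = ⊥) (g : unipotentUnits J) (hg : IsOfFinOrder g) : g = 1 := by
  obtain ⟨n, hn, hgn⟩ := isOfFinOrder_iff_pow_eq_one.1 hg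
  have hpow : ∀ i : ℕ, (g : Aˣ).val ^ i - 1 ∈ J := fun i => by
    have := (g ^ i).2
    rw [mem_unipotentUnits] at this
    simpa using this
  set s : A := ∑ i ∈ Finset.range n, (g : Aˣ).val ^ i with hs
  have hq : (n : ℚ) ≠ 0 := by exact_mod_cast hn.ne'
  have hsn : s - (n : A) ∈ J := by
    have : s - (n : A) = ∑ i ∈ Finset.range n, ((g : Aˣ).val ^ i - 1) := by
      rw [Finset.sum_sub_distrib]; simp [hs]
    rw [this]
    exact J.sum_mem fun i _ => hpow i
  have hj : (n : ℚ)⁻¹ • (s - (n : A)) ∈ J := by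
    rw [Algebra.smul_def]; exact J.mul_mem_left _ hsn
  have hu : IsUnit (1 + (n : ℚ)⁻¹ • (s - (n : A))) :=
    (Ideal.isNilpotent_of_mem hJ hj).isUnit_one_add
  have h1 : 1 + (n : ℚ)⁻¹ • (s - (n : A)) = (n : ℚ)⁻¹ • s := by
    have : (n : ℚ)⁻¹ • (n : A) = 1 := by
      rw [Algebra.smul_def, ← map_natCast (algebraMap ℚ A) n, ← map_mul, inv_mul_cancel₀ hq, map_one]
    rw [smul_sub, this]; abel
  have h2 : ((g : Aˣ).val - 1) * ((n : ℚ)⁻¹ • s) = 0 := by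
    rw [mul_smul_comm, hs, mul_geom_sum]
    have h3 : ((g ^ n : unipotentUnits J) : Aˣ).val = 1 := by rw [hgn]; rfl
    have h4 : (g : Aˣ).val ^ n = 1 := by simpa using h3
    rw [h4, sub_self, smul_zero]
  rw [h1] at hu
  have h3 := (hu.mul_left_eq_zero).1 h2
  exact Subtype.ext (Units.ext (sub_eq_zero.1 h3))

open Polynomial in
-- Newton iteration solves `Y ^ n = X` in `ℚ[X] / (X - 1) ^ (m + 1)` from the approximate root `1`,
-- where the derivative `n` is invertible. A representative of the root is then evaluated at `u`.
-- The exponent `m + 1` is positive even if `m = 0`, so the value of the representative at `1` can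
-- be read off.
theorem exists_pow_eq_unipotentUnits (J : Ideal A) [J.IsTwoSided] {m : ℕ} (hJ : J ^ m = ⊥)
    (n : ℕ) (hn : 0 < n) (g : unipotentUnits J) : ∃ h, h ^ n = g := by
  set u : A := (g : Aˣ).val with hu
  have huJ : u - 1 ∈ J := g.2
  have hum : (u - 1) ^ (m + 1) = 0 := by
    have := Ideal.pow_mem_pow huJ m
    rw [hJ, Ideal.mem_bot] at this
    rw [pow_succ, this, zero_mul]
  set I : Ideal ℚ[X] := Ideal.span {(X - 1) ^ (m + 1)} with hI
  have haeval : ∀ p ∈ I, aeval u p = 0 := by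
    intro p hp
    obtain ⟨q, rfl⟩ := Ideal.mem_span_singleton.1 hp
    simp [hum]
  have hmk : IsNilpotent (Ideal.Quotient.mk I (X - 1)) :=
    ⟨m + 1, by rw [← map_pow]; exact Ideal.Quotient.eq_zero_iff_mem.2 (Ideal.subset_span rfl)⟩
  obtain ⟨r, ⟨hr1, hr2⟩, -⟩ := existsUnique_nilpotent_sub_and_aeval_eq_zero
    (R := ℚ[X] ⧸ I) (S := ℚ[X] ⧸ I) (P := X ^ n - C (Ideal.Quotient.mk I X)) (x := 1)
    (by
      have : aeval (1 : ℚ[X] ⧸ I) (X ^ n - C (Ideal.Quotient.mk I X)) =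
        -(Ideal.Quotient.mk I (X - 1)) := by simp
      rw [this]; exact hmk.neg)
    (by
      have h1 : aeval (1 : ℚ[X] ⧸ I) (derivative (X ^ n - C (Ideal.Quotient.mk I X))) =
        algebraMap ℚ (ℚ[X] ⧸ I) n := by simp [derivative_X_pow]
      rw [h1]
      exact (IsUnit.mk0 (n : ℚ) (by exact_mod_cast hn.ne')).map _)
  obtain ⟨p, rfl⟩ := Ideal.Quotient.mk_surjective r
  have hpn : p ^ n - X ∈ I := by
    rw [← Ideal.Quotient.eq_zero_iff_mem]
    simpa using hr2
  have hp1 : p.eval 1 = 1 := by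
    obtain ⟨k, hk⟩ := hr1
    rw [← map_one (Ideal.Quotient.mk I), ← map_sub, ← map_pow, Ideal.Quotient.eq_zero_iff_mem] at hk
    obtain ⟨q, hq⟩ := Ideal.mem_span_singleton.1 hk
    have h1 := congrArg (eval 1) hq
    simp only [eval_pow, eval_sub, eval_one, eval_mul, eval_X, sub_self, ne_eq, Nat.succ_ne_zero,
      not_false_eq_true, zero_pow, zero_mul] at h1
    exact (sub_eq_zero.1 (IsReduced.eq_zero _ ⟨k, h1⟩)).symm
  have hroot : aeval u p ^ n = u := by
    have h1 := haeval _ hpn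
    rwa [map_sub, map_pow, aeval_X, sub_eq_zero] at h1
  have hpJ : aeval u p - 1 ∈ J := by
    rw [← Ideal.Quotient.eq_zero_iff_mem, map_sub, map_one, sub_eq_zero]
    have h1 : Ideal.Quotient.mkₐ ℚ J (aeval u p) = aeval (Ideal.Quotient.mkₐ ℚ J u) p :=
      (aeval_algHom_apply (Ideal.Quotient.mkₐ ℚ J) u p).symm
    have h2 : Ideal.Quotient.mkₐ ℚ J u = 1 := by
      rw [← map_one (Ideal.Quotient.mkₐ ℚ J)]
      exact Ideal.Quotient.eq.2 huJ
    rw [h2, ← map_one (algebraMap ℚ (A ⧸ J)), aeval_algebraMap_apply,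
      coe_aeval_eq_eval, hp1] at h1
    simpa using h1
  have hunit : IsUnit (aeval u p) := by
    have := (Ideal.isNilpotent_of_mem hJ hpJ).isUnit_one_add
    rwa [add_sub_cancel] at this
  obtain ⟨v, hv⟩ := hunit
  refine ⟨⟨v, by rw [mem_unipotentUnits, hv]; exact hpJ⟩, Subtype.ext (Units.ext ?_)⟩
  change (v : A) ^ n = u
  rw [hv, hroot]

end NilpotentIdeal

/-! ### Congruence subgroups of unipotent representations. -/

section Congruence

variable {A : Type v} [Ring A] {G : Type u} [Group G]

theorem map_pow_sub_one_mem (J : Ideal A) [J.IsTwoSided] {l : ℕ} (hl : 0 < l) {ρ : G →* A} {g : G}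
    (hg : ρ g - 1 ∈ J ^ l) (n : ℕ) :
    ρ (g ^ n) - 1 ∈ J ^ l ∧ ρ (g ^ n) - 1 - n • (ρ g - 1) ∈ J ^ (l + 1) := by
  induction n with
  | zero => simp
  | succ n ih =>
    have h0 : (ρ (g ^ n) - 1) * (ρ g - 1) ∈ J ^ (l + l) := J.mul_mem_pow_add ih.1 hg
    constructor
    · have : ρ (g ^ (n + 1)) - 1 = (ρ (g ^ n) - 1) * (ρ g - 1) + (ρ (g ^ n) - 1) + (ρ g - 1) := by
        rw [pow_succ, map_mul]; noncomm_ring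
      rw [this]
      exact (J ^ l).add_mem ((J ^ l).add_mem (Ideal.pow_le_pow_right (by omega) h0) ih.1) hg
    · have : ρ (g ^ (n + 1)) - 1 - (n + 1) • (ρ g - 1) =
          (ρ (g ^ n) - 1) * (ρ g - 1) + (ρ (g ^ n) - 1 - n • (ρ g - 1)) := by
        rw [pow_succ, map_mul, add_smul, one_smul]; noncomm_ring
      rw [this]
      exact (J ^ (l + 1)).add_mem (Ideal.pow_le_pow_right (by omega) h0) ih.2

/-- Let `ρ` be a faithful unipotent representation of `G`, and `H` a subgroup such that every
element of `G` has a positive power in `H`, with `ρ H` contained in a subring `B` which is finitely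
generated as an additive group. Then `H` contains a principal congruence subgroup. -/
theorem exists_mem_of_map_sub_one_eq_nsmul (J : Ideal A) [J.IsTwoSided] {m : ℕ} (hJ : J ^ m = ⊥)
    (ρ : G →* A) (hρJ : ∀ g, ρ g - 1 ∈ J) (hinj : Function.Injective ρ) (H : Subgroup G)
    (hH : ∀ g : G, ∃ n : ℕ, 0 < n ∧ g ^ n ∈ H) (B : Subalgebra ℤ A)
    (hB : (Subalgebra.toSubmodule B).FG) (hHB : ∀ h ∈ H, ρ h ∈ B) :
    ∃ n : ℕ, 0 < n ∧ ∀ w : G, ∀ b ∈ B, ρ w - 1 = n • b → w ∈ H := by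
  have hBfin : Module.Finite ℤ B := Module.Finite.iff_fg.2 hB
  -- Induction on `i`, a bound for `m - l`, for elements `w` with `ρ w ∈ 1 + J ^ l`; once `l ≥ m`
  -- only `w = 1` is left.
  have key : ∀ i l : ℕ, 0 < l → m ≤ l + i → ∃ n : ℕ, 0 < n ∧ ∀ w : G, ρ w - 1 ∈ J ^ l →
      ∀ b ∈ B, ρ w - 1 = n • b → w ∈ H := by
    intro i
    induction i with
    | zero =>
      intro l _ hml
      refine ⟨1, one_pos, fun w hw _ _ _ => ?_⟩
      have h1 := Ideal.pow_le_pow_right hml hw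
      rw [add_zero] at hml
      rw [hJ, Ideal.mem_bot, sub_eq_zero, ← map_one ρ] at h1
      rw [hinj h1]
      exact H.one_mem
    | succ i ih =>
      intro l hl hml
      obtain ⟨n₁, hn₁, hind⟩ := ih (l + 1) (by omega) (by omega)
      -- `T` is the set of elements congruent modulo `J ^ (l + 1)` to some `ρ y - 1` in `J ^ l` with
      -- `y ∈ H`. It is additive because products of two elements of `J ^ l` lie in `J ^ (l + 1)`.
      let T : AddSubgroup A :=
        { carrier := {a | ∃ y ∈ H, ρ y - 1 ∈ J ^ l ∧ a - (ρ y - 1) ∈ J ^ (l + 1)}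
          zero_mem' := ⟨1, H.one_mem, by simp, by simp⟩
          add_mem' := by
            rintro a b ⟨y, hy, hyl, hay⟩ ⟨z, hz, hzl, hbz⟩
            have h0 : (ρ y - 1) * (ρ z - 1) ∈ J ^ (l + l) := J.mul_mem_pow_add hyl hzl
            refine ⟨y * z, H.mul_mem hy hz, ?_, ?_⟩
            · have : ρ (y * z) - 1 = (ρ y - 1) * (ρ z - 1) + (ρ y - 1) + (ρ z - 1) := by
                rw [map_mul]; noncomm_ring
              rw [this]
              exact (J ^ l).add_mem ((J ^ l).add_mem (Ideal.pow_le_pow_right (by omega) h0) hyl) hzl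
            · have : a + b - (ρ (y * z) - 1) =
                  (a - (ρ y - 1)) + (b - (ρ z - 1)) - (ρ y - 1) * (ρ z - 1) := by
                rw [map_mul]; noncomm_ring
              rw [this]
              exact (J ^ (l + 1)).sub_mem ((J ^ (l + 1)).add_mem hay hbz)
                (Ideal.pow_le_pow_right (by omega) h0)
          neg_mem' := by
            rintro a ⟨y, hy, hyl, hay⟩
            have hinv : ρ y⁻¹ * ρ y = 1 := by rw [← map_mul, inv_mul_cancel, map_one]
            have h1 : ρ y⁻¹ - 1 = -(ρ y⁻¹ * (ρ y - 1)) := by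
              rw [mul_sub, hinv]; noncomm_ring
            have h2 : ρ y⁻¹ - 1 ∈ J ^ l := by
              rw [h1]; exact (J ^ l).neg_mem ((J ^ l).mul_mem_left _ hyl)
            have h0 : (ρ y⁻¹ - 1) * (ρ y - 1) ∈ J ^ (l + l) := J.mul_mem_pow_add h2 hyl
            refine ⟨y⁻¹, H.inv_mem hy, h2, ?_⟩
            have : -a - (ρ y⁻¹ - 1) = -(a - (ρ y - 1)) + (ρ y⁻¹ - 1) * (ρ y - 1) := by
              rw [sub_mul, mul_sub, hinv]; noncomm_ring
            rw [this]
            exact (J ^ (l + 1)).add_mem ((J ^ (l + 1)).neg_mem hay)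
              (Ideal.pow_le_pow_right (by omega) h0) }
      let B' : Submodule ℤ A :=
        { carrier := {b | b ∈ B ∧ ∃ r : ℕ, 0 < r ∧ r • b ∈ T}
          zero_mem' := ⟨B.zero_mem, 1, one_pos, by simp⟩
          add_mem' := by
            rintro a b ⟨ha, r, hr, hra⟩ ⟨hb, s, hs, hsb⟩
            refine ⟨B.add_mem ha hb, r * s, Nat.mul_pos hr hs, ?_⟩
            rw [smul_add]
            refine T.add_mem ?_ ?_
            · rw [mul_comm, mul_smul]; exact T.nsmul_mem hra s
            · rw [mul_smul]; exact T.nsmul_mem hsb r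
          smul_mem' := by
            rintro c a ⟨ha, r, hr, hra⟩
            refine ⟨B.smul_mem ha c, r, hr, ?_⟩
            rw [smul_comm]; exact T.zsmul_mem hra c }
      have hB' : B'.FG := hB.of_le fun b hb => hb.1
      obtain ⟨e, he, heT⟩ := hB'.exists_nsmul_mem (AddSubgroup.toIntSubmodule T) fun b hb => hb.2
      obtain ⟨n', hn', hiter⟩ := exists_iterate_sub_self_eq_nsmul (M := B) hn₁
      -- The factor `e` turns `b` into an element of `T`, represented by some `y ∈ H`; `n'` makes
      -- `y⁻¹ ^ n'` congruent to `1` modulo `n₁ B`; `n₁` makes `w` so. Then `y⁻¹ ^ n' * w` lies one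
      -- step deeper and is congruent to `1` modulo `n₁ B`, so the induction hypothesis puts it in
      -- `H`.
      refine ⟨n₁ * (n' * e), Nat.mul_pos hn₁ (Nat.mul_pos hn' he), fun w hw b₀ hb₀ hwb₀ => ?_⟩
      obtain ⟨b, hb, hbb₀⟩ : ∃ b ∈ B, b = n₁ • b₀ := ⟨_, B.nsmul_mem hb₀ n₁, rfl⟩
      have hwb : ρ w - 1 = (n' * e) • b := by rw [hwb₀, hbb₀, mul_comm, mul_smul]
      have hbB' : b ∈ B' := by
        obtain ⟨r, hr, hrw⟩ := hH w
        refine ⟨hb, r * (n' * e), Nat.mul_pos hr (Nat.mul_pos hn' he), w ^ r, hrw, ?_⟩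
        obtain ⟨h1, h2⟩ := map_pow_sub_one_mem J hl hw r
        refine ⟨h1, ?_⟩
        rw [mul_smul, ← hwb, ← neg_sub]
        exact (J ^ (l + 1)).neg_mem h2
      obtain ⟨y, hy, hyl, hyb⟩ := heT b hbB'
      have hinvB : ∀ y ∈ H, ρ y⁻¹ * ρ y = 1 := fun y _ => by
        rw [← map_mul, inv_mul_cancel, map_one]
      obtain ⟨z, hz⟩ : ∃ z ∈ B, ρ (y⁻¹ ^ n') - 1 = n₁ • z := by
        -- Left multiplication by `ρ y⁻¹` is onto `B`, since `ρ y ∈ B`; its iterates at `1` are the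
        -- `ρ (y⁻¹ ^ k)`.
        let f : B →ₗ[ℤ] B := LinearMap.mulLeft ℤ ⟨ρ y⁻¹, hHB _ (H.inv_mem hy)⟩
        obtain ⟨z, hz⟩ := hiter f (fun x => ⟨⟨ρ y, hHB y hy⟩ * x, 0, by
          apply Subtype.ext
          change (x : A) = ρ y⁻¹ * (ρ y * x) + ((n₁ • (0 : B) : B) : A)
          rw [← mul_assoc, hinvB y hy]; simp⟩) 1
        refine ⟨z, z.2, ?_⟩
        have h1 : ∀ k : ℕ, ((f^[k] 1 : B) : A) = ρ (y⁻¹ ^ k) := by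
          intro k
          induction k with
          | zero => simp
          | succ k ihk =>
            rw [Function.iterate_succ_apply', pow_succ', map_mul, ← ihk]
            rfl
        have h2 := congrArg (Subtype.val : B → A) hz
        rw [← h1]
        simpa using h2
      obtain ⟨hzB, hz⟩ := hz
      have hyn : y⁻¹ ^ n' ∈ H := H.pow_mem (H.inv_mem hy) n'
      have hcancel : ρ (y⁻¹ ^ n') * ρ (y ^ n') = 1 := by
        rw [← map_mul, inv_pow, inv_mul_cancel, map_one]
      have h1 : ρ w - ρ (y ^ n') ∈ J ^ (l + 1) := by
        have h2 := (map_pow_sub_one_mem J hl hyl n').2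
        have h3 : ρ w - ρ (y ^ n') =
            n' • (e • b - (ρ y - 1)) - (ρ (y ^ n') - 1 - n' • (ρ y - 1)) := by
          rw [smul_sub, ← mul_smul, ← hwb]; abel
        rw [h3]
        refine (J ^ (l + 1)).sub_mem ?_ h2
        exact (J ^ (l + 1)).toAddSubmonoid.nsmul_mem hyb n'
      have hv : y⁻¹ ^ n' * w ∈ H := by
        refine hind _ ?_ (ρ (y⁻¹ ^ n') * ((n' * e) • b₀) + z) ?_ ?_
        · have : ρ (y⁻¹ ^ n' * w) - 1 = ρ (y⁻¹ ^ n') * (ρ w - ρ (y ^ n')) := by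
            rw [mul_sub, hcancel, map_mul]
          rw [this]
          exact (J ^ (l + 1)).mul_mem_left _ h1
        · exact B.add_mem (B.mul_mem (hHB _ hyn) (B.nsmul_mem hb₀ _)) hzB
        · have : ρ (y⁻¹ ^ n' * w) - 1 = ρ (y⁻¹ ^ n') * (ρ w - 1) + (ρ (y⁻¹ ^ n') - 1) := by
            rw [mul_sub, map_mul, mul_one]; abel
          rw [this, hz, hwb₀, mul_smul n₁, smul_add, mul_smul_comm n₁]
      have := H.mul_mem (H.inv_mem hyn) hv
      rwa [inv_mul_cancel_left] at this
  obtain ⟨n, hn, h⟩ := key m 1 one_pos (by omega)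
  exact ⟨n, hn, fun w b hb hw => h w (by rw [Submodule.pow_one]; exact hρJ w) b hb hw⟩

end Congruence

/-! ### Logarithms, integral subrings and integral determinants. -/

open Polynomial in
-- The truncated logarithm is `P = X * (1 + X * Q)`, so `x ^ j` equals `P(x) ^ j` minus a
-- combination of higher powers of `x`. Descending induction on `j` inverts the logarithm without an
-- exponential series.
theorem mem_of_sum_log_mem {A : Type v} [Ring A] [Algebra ℚ A] {c : ℕ} {x : A}
    (hx : x ^ (c + 1) = 0) (C : Subalgebra ℚ A)
    (h : ∑ k ∈ Finset.Icc 1 c, ((-1 : ℚ) ^ (k + 1) / k) • x ^ k ∈ C) : x ∈ C := by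
  rcases Nat.eq_zero_or_pos c with rfl | hc
  · rw [zero_add, pow_one] at hx
    rw [hx]; exact C.zero_mem
  set P : ℚ[X] := ∑ k ∈ Finset.Icc 1 c, ((-1 : ℚ) ^ (k + 1) / k) • X ^ k with hP
  have hPx : aeval x P ∈ C := by simpa [hP] using h
  obtain ⟨Q, hQ⟩ : ∃ Q, P = X * (1 + X * Q) := by
    have h1 : X ^ 2 ∣ ∑ k ∈ Finset.Icc 2 c, ((-1 : ℚ) ^ (k + 1) / k) • (X : ℚ[X]) ^ k :=
      Finset.dvd_sum fun k hk =>
        dvd_smul_of_dvd _ (pow_dvd_pow X (Finset.mem_Icc.1 hk).1)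
    obtain ⟨Q, hQ⟩ := h1
    refine ⟨Q, ?_⟩
    rw [hP, ← Finset.insert_Icc_add_one_left_eq_Icc hc, Finset.sum_insert (by simp), one_add_one_eq_two, hQ]
    norm_num
    ring
  have key : ∀ i j : ℕ, c + 1 ≤ j + i → x ^ j ∈ C := by
    intro i
    induction i with
    | zero =>
      intro j hj
      rw [pow_eq_zero_of_le (by omega) hx]
      exact C.zero_mem
    | succ i ih =>
      intro j hj
      obtain ⟨R, hR⟩ : ∃ R, P ^ j = X ^ j + X ^ (j + 1) * R := by
        obtain ⟨R, hR⟩ := sub_dvd_pow_sub_pow (1 + X * Q) 1 j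
        refine ⟨Q * R, ?_⟩
        rw [one_pow, sub_eq_iff_eq_add] at hR
        rw [hQ, mul_pow, hR]; ring
      have h1 : aeval x (X ^ (j + 1) * R) ∈ C := by
        rw [map_mul, map_pow, aeval_X, aeval_eq_sum_range, Finset.mul_sum]
        refine C.sum_mem fun k _ => ?_
        rw [mul_smul_comm, ← pow_add]
        exact C.smul_mem (ih _ (by omega)) _
      have h2 : x ^ j = aeval x P ^ j - aeval x (X ^ (j + 1) * R) := by
        rw [← map_pow, ← map_sub, hR, add_sub_cancel_right, map_pow, aeval_X]
      rw [h2]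
      exact C.sub_mem (C.pow_mem hPx j) h1
  simpa using key c 1 (by omega)

/-- Adjoin `S` and the elements `ρ g - 1` for `g` in a finite set generating `H` as a monoid, so
that inverses need no separate care. All these generators lie in the nilpotent ideal `J`. -/
theorem exists_fg_subalgebra_int {A : Type v} [Ring A] (J : Ideal A) [J.IsTwoSided] {m : ℕ}
    (hJ : J ^ m = ⊥) {G : Type u} [Group G] (ρ : G →* A) (hρJ : ∀ g, ρ g - 1 ∈ J) {H : Subgroup G}
    (hH : H.FG) (S : Submodule ℤ A) (hS : S.FG) (hSJ : ∀ x ∈ S, x ∈ J) :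
    ∃ B : Subalgebra ℤ A, (Subalgebra.toSubmodule B).FG ∧ (∀ x ∈ S, x ∈ B) ∧ ∀ h ∈ H, ρ h ∈ B := by
  obtain ⟨X, hX, hXfin⟩ := (Submonoid.fg_iff _).1 ((Subgroup.fg_iff_submonoid_fg H).1 hH)
  set T : Submodule ℤ A := Submodule.span ℤ ((fun g => ρ g - 1) '' X) with hT
  have hTJ : ∀ x ∈ T, x ∈ J := by
    intro x hx
    have : T ≤ J.restrictScalars ℤ := by
      rw [hT, Submodule.span_le]
      rintro _ ⟨g, _, rfl⟩
      exact hρJ g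
    exact this hx
  refine ⟨Algebra.adjoin ℤ ((S ⊔ T : Submodule ℤ A) : Set A),
    Algebra.fg_adjoin_int_of_isNilpotent J hJ _
      (hS.sup (Submodule.fg_span (hXfin.image _))) ?_, ?_, ?_⟩
  · intro x hx
    obtain ⟨y, hy, z, hz, rfl⟩ := Submodule.mem_sup.1 hx
    exact J.add_mem (hSJ y hy) (hTJ z hz)
  · exact fun x hx => Algebra.subset_adjoin (Submodule.mem_sup_left hx)
  · intro h hh
    have hh' : h ∈ Submonoid.closure X := by rw [hX]; exact hh
    induction hh' using Submonoid.closure_induction with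
    | mem g hg =>
      have h1 : ρ g - 1 ∈ Algebra.adjoin ℤ ((S ⊔ T : Submodule ℤ A) : Set A) :=
        Algebra.subset_adjoin (Submodule.mem_sup_right (Submodule.subset_span ⟨g, hg, rfl⟩))
      have := Subalgebra.add_mem _ h1 (Subalgebra.one_mem _)
      rwa [sub_add_cancel] at this
    | one => rw [map_one]; exact Subalgebra.one_mem _
    | mul a b ha hb iha ihb =>
      rw [map_mul]
      refine Subalgebra.mul_mem _ (iha ?_) (ihb ?_)
      · have : a ∈ H.toSubmonoid := hX ▸ ha
        exact this
      · have : b ∈ H.toSubmonoid := hX ▸ hb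
        exact this

/-- A `ℤ`-basis of `S` is a `ℚ`-basis of `V` in which `f` has an integral matrix, and the adjugate
of that matrix produces `y` from `x`. -/
theorem LinearMap.exists_int_eq_det {V : Type v} [AddCommGroup V] [Module ℚ V] (S : Submodule ℤ V)
    (hS : S.FG) (hspan : Submodule.span ℚ (S : Set V) = ⊤) (f : V →ₗ[ℚ] V)
    (hf : ∀ x ∈ S, f x ∈ S) :
    ∃ d : ℤ, LinearMap.det f = d ∧ ∀ x ∈ S, ∃ y ∈ S, d • x = f y := by
  classical
  have : Module.Finite ℤ S := Module.Finite.iff_fg.2 hS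
  have : IsAddTorsionFree V := .of_module_rat V
  let b := Module.finBasis ℤ S
  let fS : S →ₗ[ℤ] S := (f.restrictScalars ℤ).restrict hf
  have hli : LinearIndependent ℚ (fun i => (b i : V)) := by
    rw [← LinearIndependent.iff_fractionRing ℤ ℚ]
    exact b.linearIndependent.map' S.subtype (Submodule.ker_subtype S)
  have hsp : ⊤ ≤ Submodule.span ℚ (Set.range fun i => (b i : V)) := by
    rw [← hspan, Submodule.span_le]
    intro x hx
    have h1 : (⟨x, hx⟩ : S) ∈ Submodule.span ℤ (Set.range b) := b.span_eq ▸ Submodule.mem_top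
    have h2 := Submodule.mem_map_of_mem (f := S.subtype) h1
    rw [Submodule.map_span, ← Set.range_comp] at h2
    exact Submodule.span_le_restrictScalars ℤ ℚ _ h2
  let b' := Module.Basis.mk hli hsp
  have hmat : LinearMap.toMatrix b' b' f = (LinearMap.toMatrix b b fS).map (Int.castRingHom ℚ) := by
    ext i j
    rw [LinearMap.toMatrix_apply, Matrix.map_apply, LinearMap.toMatrix_apply]
    have h1 : f (b' j) = ∑ i, ((b.repr (fS (b j)) i : ℤ) : ℚ) • b' i := by
      have h2 := congrArg S.subtype (b.sum_repr (fS (b j)))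
      rw [map_sum] at h2
      rw [Module.Basis.mk_apply]
      refine (h2.symm.trans ?_)
      refine Finset.sum_congr rfl fun i _ => ?_
      rw [map_smul, Module.Basis.mk_apply, Int.cast_smul_eq_zsmul]
      rfl
    rw [h1, Module.Basis.repr_sum_self]
    rfl
  refine ⟨LinearMap.det fS, ?_, fun x hx => ?_⟩
  · rw [← LinearMap.det_toMatrix b', hmat, ← RingHom.mapMatrix_apply, ← RingHom.map_det,
      LinearMap.det_toMatrix]
    rfl
  · let g : S →ₗ[ℤ] S := Matrix.toLin b b (LinearMap.toMatrix b b fS).adjugate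
    have hg : fS ∘ₗ g = LinearMap.det fS • LinearMap.id := by
      apply (LinearMap.toMatrix b b).injective
      rw [LinearMap.toMatrix_comp b b b, LinearMap.toMatrix_toLin, Matrix.mul_adjugate,
        LinearMap.det_toMatrix, map_smul, LinearMap.toMatrix_id]
    refine ⟨g ⟨x, hx⟩, (g ⟨x, hx⟩).2, ?_⟩
    have h1 := congrArg Subtype.val (LinearMap.congr_fun hg ⟨x, hx⟩)
    exact h1.symm

/-! ### The lattice spanned by logarithms in the truncated group algebra. -/

namespace Malcev

section Truncated

variable (N : Type u) [Group N]

/-- The augmentation of the truncated group algebra. -/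
noncomputable def truncatedAugmentation : TruncatedGroupAlgebra N →ₐ[ℚ] ℚ :=
  Ideal.Quotient.liftₐ _ (augmentation N) fun _ hx =>
    Ideal.pow_le_self (Nat.succ_ne_zero _) hx

/-- The augmentation ideal of the truncated group algebra. -/
noncomputable def truncatedAugIdeal : Ideal (TruncatedGroupAlgebra N) :=
  RingHom.ker (truncatedAugmentation N)

instance : (truncatedAugIdeal N).IsTwoSided := by
  unfold truncatedAugIdeal; infer_instance

theorem truncatedAugIdeal_pow :
    truncatedAugIdeal N ^ (Group.nilpotencyClass N + 1) = ⊥ := by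
  have h : ∀ k, ∀ x ∈ truncatedAugIdeal N ^ k,
      ∃ y ∈ augIdeal N ^ k, Ideal.Quotient.mk (augIdeal N ^ (Group.nilpotencyClass N + 1)) y = x := by
    intro k
    induction k with
    | zero =>
      intro x _
      obtain ⟨y, rfl⟩ := Ideal.Quotient.mk_surjective x
      exact ⟨y, by rw [Submodule.pow_zero, Ideal.one_eq_top]; trivial, rfl⟩
    | succ k ih =>
      intro x hx
      have hk : truncatedAugIdeal N ^ (k + 1) = truncatedAugIdeal N ^ k * truncatedAugIdeal N :=
        Submodule.pow_succ _
      rw [hk] at hx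
      refine Submodule.mul_induction_on hx ?_ ?_
      · intro a ha b hb
        obtain ⟨a, ha', rfl⟩ := ih a ha
        obtain ⟨b, rfl⟩ := Ideal.Quotient.mk_surjective b
        refine ⟨a * b, ?_, map_mul _ _ _⟩
        rw [Submodule.pow_succ]
        exact Ideal.mul_mem_mul ha' hb
      · rintro _ _ ⟨a, ha, rfl⟩ ⟨b, hb, rfl⟩
        exact ⟨a + b, Ideal.add_mem _ ha hb, map_add _ _ _⟩
  rw [eq_bot_iff]
  intro x hx
  obtain ⟨y, hy, rfl⟩ := h _ x hx
  exact Ideal.Quotient.eq_zero_iff_mem.2 hy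

/-- The map from a group to its truncated group algebra, as a monoid homomorphism. -/
noncomputable def ofHom : N →* TruncatedGroupAlgebra N :=
  (Ideal.Quotient.mk (augIdeal N ^ (Group.nilpotencyClass N + 1)) :
    MonoidAlgebra ℚ N →* _).comp (MonoidAlgebra.of ℚ N)

variable {N}

theorem ofHom_apply (g : N) : ofHom N g = of g := rfl

theorem truncatedAugmentation_of (g : N) : truncatedAugmentation N (of g) = 1 := by
  have : truncatedAugmentation N (of g) = augmentation N (MonoidAlgebra.of ℚ N g) := rfl
  rw [this]
  simp [augmentation]

theorem of_sub_one_mem (g : N) : of g - 1 ∈ truncatedAugIdeal N := by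
  change truncatedAugmentation N (of g - 1) = 0
  rw [map_sub, truncatedAugmentation_of, map_one, sub_self]

theorem truncatedAugmentation_algMap (φ : N →* N) (x : TruncatedGroupAlgebra N) :
    truncatedAugmentation N (algMap φ x) = truncatedAugmentation N x := by
  obtain ⟨x, rfl⟩ := Ideal.Quotient.mk_surjective x
  exact DFunLike.congr_fun (augmentation_comp_map φ) x

theorem algMap_sub_one_mem (φ : N →* N) {x : TruncatedGroupAlgebra N}
    (hx : x - 1 ∈ truncatedAugIdeal N) : algMap φ x - 1 ∈ truncatedAugIdeal N := by
  change truncatedAugmentation N _ = 0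
  rw [← map_one (algMap φ), ← map_sub, truncatedAugmentation_algMap]
  exact hx

theorem ofHom_injective (hN : IsFGroup N) : Function.Injective (ofHom N) := by
  have h : ∀ g : N, ofHom N g = 1 → g = 1 := by
    intro g hg
    refine eq_one_of_of_sub_one_mem hN ?_
    rw [← Ideal.Quotient.eq_zero_iff_mem, map_sub, map_one, sub_eq_zero]
    exact hg
  intro a b hab
  refine inv_mul_eq_one.1 (h _ ?_)
  rw [map_mul, ← hab, ← map_mul, inv_mul_cancel, map_one]

theorem log_mem_truncatedAugIdeal (g : N) : log g ∈ truncatedAugIdeal N := by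
  refine Ideal.sum_mem _ fun k hk => Submodule.smul_of_tower_mem _ _ ?_
  exact Ideal.pow_mem_of_mem _ (of_sub_one_mem g) k (Finset.mem_Icc.1 hk).1

variable (N) in
/-- The additive group generated by the logarithms of the elements of `N`. -/
noncomputable def logLattice : Submodule ℤ (TruncatedGroupAlgebra N) :=
  Submodule.span ℤ (Set.range (log (N := N)))

theorem mem_truncatedAugIdeal_of_mem_logLattice (x : TruncatedGroupAlgebra N)
    (hx : x ∈ logLattice N) : x ∈ truncatedAugIdeal N := by
  have : logLattice N ≤ (truncatedAugIdeal N).restrictScalars ℤ := by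
    rw [logLattice, Submodule.span_le]
    rintro _ ⟨g, rfl⟩
    exact log_mem_truncatedAugIdeal g
  exact this hx

/-- The denominators in `log g` divide `c!`, so the lattice lies in `(c!)⁻¹ B` for a finitely
generated subring `B` containing the image of `N`. -/
theorem logLattice_fg [Group.FG N] : (logLattice N).FG := by
  obtain ⟨B, hB, -, hBof⟩ := exists_fg_subalgebra_int (truncatedAugIdeal N)
    (truncatedAugIdeal_pow N) (ofHom N) of_sub_one_mem (H := ⊤) (Group.fg_def.1 inferInstance) ⊥
    Submodule.fg_bot (by rintro x rfl; exact Ideal.zero_mem _)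
  set c := Group.nilpotencyClass N
  set s : TruncatedGroupAlgebra N →ₗ[ℤ] TruncatedGroupAlgebra N :=
    ((c.factorial : ℚ)⁻¹ • LinearMap.id : _ →ₗ[ℚ] TruncatedGroupAlgebra N).restrictScalars ℤ with hs
  refine (hB.map s).of_le ?_
  rw [logLattice, Submodule.span_le]
  rintro _ ⟨g, rfl⟩
  refine ⟨(c.factorial : ℚ) • log g, ?_, ?_⟩
  · rw [log, Finset.smul_sum]
    refine B.sum_mem fun k hk => ?_
    obtain ⟨hk1, hkc⟩ := Finset.mem_Icc.1 hk
    obtain ⟨a, ha⟩ : k ∣ c.factorial := Nat.dvd_factorial hk1 hkc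
    have hk0 : (k : ℚ) ≠ 0 := by exact_mod_cast (by omega : k ≠ 0)
    have h1 : (c.factorial : ℚ) * ((-1 : ℚ) ^ (k + 1) / k) = (((-1) ^ (k + 1) * a : ℤ) : ℚ) := by
      rw [ha]; push_cast; field_simp
    rw [smul_smul, h1, Int.cast_smul_eq_zsmul]
    refine B.smul_mem (B.pow_mem (B.sub_mem (hBof g (Subgroup.mem_top g)) B.one_mem) k) _
  · have hc : (c.factorial : ℚ) ≠ 0 := by exact_mod_cast c.factorial_ne_zero
    simp [hs, smul_smul, inv_mul_cancel₀ hc]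

/-- The elements with a positive multiple in the subring form a `ℚ`-subalgebra. It contains every
`log g`, hence every `of g` by `mem_of_sum_log_mem`, and these span. -/
theorem exists_nsmul_mem_adjoin_logLattice (x : TruncatedGroupAlgebra N) :
    ∃ n : ℕ, 0 < n ∧ n • x ∈ Algebra.adjoin ℤ (logLattice N : Set (TruncatedGroupAlgebra N)) := by
  set B := Algebra.adjoin ℤ (logLattice N : Set (TruncatedGroupAlgebra N)) with hB
  let C : Subalgebra ℚ (TruncatedGroupAlgebra N) :=
    { carrier := {x | ∃ n : ℕ, 0 < n ∧ n • x ∈ B}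
      mul_mem' := by
        rintro a b ⟨m, hm, ha⟩ ⟨n, hn, hb⟩
        exact ⟨m * n, Nat.mul_pos hm hn, by rw [← smul_mul_smul_comm]; exact B.mul_mem ha hb⟩
      add_mem' := by
        rintro a b ⟨m, hm, ha⟩ ⟨n, hn, hb⟩
        refine ⟨m * n, Nat.mul_pos hm hn, ?_⟩
        rw [smul_add]
        refine B.add_mem ?_ ?_
        · rw [mul_comm, mul_smul]; exact B.nsmul_mem ha n
        · rw [mul_smul]; exact B.nsmul_mem hb m
      algebraMap_mem' := fun q => by
        refine ⟨q.den, q.den_pos, ?_⟩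
        rw [← Nat.cast_smul_eq_nsmul ℚ, Algebra.smul_def, ← map_mul, Rat.den_mul_eq_num, map_intCast]
        exact B.intCast_mem _ }
  have hlog : ∀ g : N, log g ∈ C := fun g =>
    ⟨1, one_pos, by rw [one_smul]; exact Algebra.subset_adjoin (Submodule.subset_span ⟨g, rfl⟩)⟩
  have hof : ∀ g : N, of g ∈ C := by
    intro g
    have h0 : (of g - 1) ^ (Group.nilpotencyClass N + 1) = 0 := by
      have := Ideal.pow_mem_pow (of_sub_one_mem g) (Group.nilpotencyClass N + 1)
      rwa [truncatedAugIdeal_pow, Ideal.mem_bot] at this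
    have h1 := mem_of_sum_log_mem h0 C (hlog g)
    have := C.add_mem h1 C.one_mem
    rwa [sub_add_cancel] at this
  have hall : ∀ y : MonoidAlgebra ℚ N,
      Ideal.Quotient.mk (augIdeal N ^ (Group.nilpotencyClass N + 1)) y ∈ C := by
    intro y
    induction y using MonoidAlgebra.induction_on with
    | of g => exact hof g
    | add a b ha hb => rw [map_add]; exact C.add_mem ha hb
    | smul r a ha => exact C.smul_mem ha r
  obtain ⟨y, rfl⟩ := Ideal.Quotient.mk_surjective x
  exact hall y

theorem algMap_mem_logLattice (φ : N →* N) (x : TruncatedGroupAlgebra N) (hx : x ∈ logLattice N) :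
    algMap φ x ∈ logLattice N := by
  have : logLattice N ≤ (logLattice N).comap ((algMap φ).toLinearMap.restrictScalars ℤ) := by
    conv_lhs => rw [logLattice]
    rw [Submodule.span_le]
    rintro _ ⟨g, rfl⟩
    exact Submodule.subset_span ⟨φ g, (algMap_log φ g).symm⟩
  exact this hx

/-- The determinant of an endomorphism of a finitely generated group is an integer `d`, and
multiplication by `d` maps the lattice generated by the logarithms into its image. -/
theorem exists_int_eq_det [Group.FG N] (φ : N →* N) :
    ∃ d : ℤ, det φ = d ∧ ∀ x ∈ logLattice N, ∃ y ∈ logLattice N, d • x = algMap φ y := by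
  let i : lieAlg N →ₗ[ℤ] TruncatedGroupAlgebra N := (lieAlg N).subtype.restrictScalars ℤ
  have hle : ∀ x ∈ logLattice N, x ∈ lieAlg N := fun x hx =>
    Submodule.span_le_restrictScalars ℤ ℚ _ hx
  have hi : Function.Injective i := Subtype.val_injective
  have hfg : ((logLattice N).comap i).FG := by
    refine Submodule.fg_of_fg_map_injective i hi ?_
    exact logLattice_fg.of_le (Submodule.map_comap_le _ _)
  have hspan : Submodule.span ℚ (((logLattice N).comap i : Submodule ℤ (lieAlg N)) :
      Set (lieAlg N)) = ⊤ := by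
    rw [eq_top_iff]
    rintro ⟨x, hx⟩ -
    have hx' := hx
    rw [lieAlg] at hx'
    induction hx' using Submodule.span_induction with
    | mem x h =>
      obtain ⟨g, rfl⟩ := h
      exact Submodule.subset_span (show log g ∈ logLattice N from Submodule.subset_span ⟨g, rfl⟩)
    | zero => exact Submodule.zero_mem _
    | add a b ha hb iha ihb => exact Submodule.add_mem _ (iha ha) (ihb hb)
    | smul q a ha iha => exact Submodule.smul_mem _ q (iha ha)
  obtain ⟨d, hd, h⟩ := LinearMap.exists_int_eq_det _ hfg hspan (lieMap φ) fun x hx =>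
    algMap_mem_logLattice φ x hx
  refine ⟨d, hd, fun x hx => ?_⟩
  obtain ⟨y, hy, hxy⟩ := h ⟨x, hle x hx⟩ hx
  exact ⟨y, hy, congrArg Subtype.val hxy⟩

end Truncated

end Malcev

/-- If an algebra endomorphism is surjective modulo `q` on a lattice `S`, then it is so on the
subring generated by `S`. -/
theorem exists_eq_map_add_nsmul_of_mem_adjoin {A : Type v} [Ring A] [Algebra ℚ A] {S : Submodule ℤ A}
    {α : A →ₐ[ℚ] A} {q : ℕ} (h : ∀ x ∈ S, ∃ y ∈ S, ∃ z ∈ S, x = α y + q • z) {x : A}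
    (hα : ∀ x ∈ Algebra.adjoin ℤ (S : Set A), α x ∈ Algebra.adjoin ℤ (S : Set A))
    (hx : x ∈ Algebra.adjoin ℤ (S : Set A)) :
    ∃ y ∈ Algebra.adjoin ℤ (S : Set A), ∃ z ∈ Algebra.adjoin ℤ (S : Set A), x = α y + q • z := by
  set B := Algebra.adjoin ℤ (S : Set A) with hB
  induction hx using Algebra.adjoin_induction with
  | mem x hx =>
    obtain ⟨y, hy, z, hz, rfl⟩ := h x hx
    exact ⟨y, Algebra.subset_adjoin hy, z, Algebra.subset_adjoin hz, rfl⟩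
  | algebraMap r => exact ⟨algebraMap ℤ A r, B.algebraMap_mem r, 0, B.zero_mem, by simp⟩
  | add x x' _ _ hx hx' =>
    obtain ⟨y, hy, z, hz, rfl⟩ := hx
    obtain ⟨y', hy', z', hz', rfl⟩ := hx'
    refine ⟨y + y', B.add_mem hy hy', z + z', B.add_mem hz hz', ?_⟩
    rw [map_add, smul_add]; abel
  | mul x x' _ _ hx hx' =>
    obtain ⟨y, hy, z, hz, rfl⟩ := hx
    obtain ⟨y', hy', z', hz', rfl⟩ := hx'
    refine ⟨y * y', B.mul_mem hy hy', α y * z' + z * α y' + q • (z * z'),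
      B.add_mem (B.add_mem (B.mul_mem (hα y hy) hz') (B.mul_mem hz (hα y' hy')))
        (B.nsmul_mem (B.mul_mem hz hz') q), ?_⟩
    simp only [map_mul, add_mul, mul_add, smul_add, smul_mul_assoc, mul_smul_comm]
    abel

/-! ### The unipotent representation of the hull. -/

namespace Malcev

/-- A homomorphism from a radicable hull of `N` to the group of unipotent units of the truncated
group algebra of `N`, which restricts to the natural embedding of `N`. -/
theorem exists_extension_ofHom {G : Type u} [Group G] {N : Subgroup G} (hN : IsFGroup N)
    (hG : IsRadicableHull N) : ∃ F : G →* unipotentUnits (truncatedAugIdeal N),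
      Function.Injective F ∧ ∀ x : N, ((F x : (TruncatedGroupAlgebra N)ˣ) : TruncatedGroupAlgebra N)
        = of x := by
  have := hG.nilpotent
  have := isNilpotent_unipotentUnits _ (truncatedAugIdeal_pow N)
  obtain ⟨F, hF⟩ := Subgroup.exists_extension_of_pow_mem
    (eq_one_of_isOfFinOrder_unipotentUnits _ (truncatedAugIdeal_pow N))
    (exists_pow_eq_unipotentUnits _ (truncatedAugIdeal_pow N)) hG.exists_pow_mem
    ((ofHom N).toHomUnits.codRestrict (unipotentUnits (truncatedAugIdeal N)) of_sub_one_mem)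
  have hF' : ∀ x : N, ((F x : (TruncatedGroupAlgebra N)ˣ) : TruncatedGroupAlgebra N) = of x :=
    fun x => by rw [hF]; rfl
  refine ⟨F, (injective_iff_map_eq_one F).2 fun g hg => ?_, hF'⟩
  obtain ⟨n, hn, hgn⟩ := hG.exists_pow_mem g
  have h1 : ofHom N ⟨g ^ n, hgn⟩ = ofHom N 1 := by
    rw [ofHom_apply, ← hF', map_one, map_pow, hg, one_pow]; rfl
  have h2 : g ^ n = 1 := congrArg Subtype.val (ofHom_injective hN h1)
  exact hG.torsionFree g (isOfFinOrder_iff_pow_eq_one.2 ⟨n, hn, h2⟩)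

/-- The unipotent representation of a radicable hull of `N` intertwines the extension of an
endomorphism of `N` with the induced endomorphism of the truncated group algebra. -/
theorem algMap_extension {G : Type u} [Group G] {N : Subgroup G} (hG : IsRadicableHull N)
    {F : G →* unipotentUnits (truncatedAugIdeal N)}
    (hF : ∀ x : N, ((F x : (TruncatedGroupAlgebra N)ˣ) : TruncatedGroupAlgebra N) = of x)
    (φ : N →* N) {ψ : G →* G} (hψ : ∀ x : N, ψ x = φ x) (g : G) :
    algMap φ ((F g : (TruncatedGroupAlgebra N)ˣ) : TruncatedGroupAlgebra N) =
      ((F (ψ g) : (TruncatedGroupAlgebra N)ˣ) : TruncatedGroupAlgebra N) := by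
  have := isNilpotent_unipotentUnits _ (truncatedAugIdeal_pow N)
  let a : unipotentUnits (truncatedAugIdeal N) →* unipotentUnits (truncatedAugIdeal N) :=
    ((Units.map (algMap φ : TruncatedGroupAlgebra N →* TruncatedGroupAlgebra N)).comp
      (Subgroup.subtype _)).codRestrict _ fun u => algMap_sub_one_mem φ u.2
  have h : a.comp F = F.comp ψ := by
    refine Subgroup.monoidHom_ext_of_pow_mem
      (eq_one_of_isOfFinOrder_unipotentUnits _ (truncatedAugIdeal_pow N)) hG.exists_pow_mem
      fun x hx => Subtype.ext (Units.ext ?_)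
    change algMap φ ((F x : (TruncatedGroupAlgebra N)ˣ) : TruncatedGroupAlgebra N) =
      ((F (ψ x) : (TruncatedGroupAlgebra N)ˣ) : TruncatedGroupAlgebra N)
    have h1 := hψ ⟨x, hx⟩
    have h2 := hF ⟨x, hx⟩
    simp only at h1 h2
    rw [h1, hF, h2, algMap_of]
  have h1 := DFunLike.congr_fun h g
  exact congrArg (fun u : unipotentUnits (truncatedAugIdeal N) =>
    ((u : (TruncatedGroupAlgebra N)ˣ) : TruncatedGroupAlgebra N)) h1

end Malcev

/-! ### Proof of the main theorem. -/

theorem theorem2p3 {G : Type*} [Group G] (N₁ N₂ : Subgroup G)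
    (h₁ : IsFGroup N₁) (h₂ : IsFGroup N₂)
    (hG₁ : IsRadicableHull N₁) (hG₂ : IsRadicableHull N₂) :
    ∃ S : Finset ℕ, (∀ p ∈ S, p.Prime) ∧
      ∀ φ : N₁ →* N₁, Function.Injective φ →
        ∃ d : ℤ, Malcev.det φ = (d : ℚ) ∧
          ∃ φQ : G →* G,
            (∀ ψ : G →* G, (∀ x : N₁, ψ (x : G) = (φ x : G)) ↔ ψ = φQ) ∧
            ((∀ p ∈ S, ¬ (p : ℤ) ∣ d) → ∃ k : ℕ, 0 < k ∧ ∀ x ∈ N₂, φQ^[k] x ∈ N₂) := by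
  have := hG₁.nilpotent
  have := h₁.fg
  obtain ⟨F, hFinj, hF⟩ := Malcev.exists_extension_ofHom h₁ hG₁
  set A := Malcev.TruncatedGroupAlgebra N₁
  let ρ : G →* A := (Units.coeHom A).comp ((Subgroup.subtype _).comp F)
  have hρJ : ∀ g, ρ g - 1 ∈ Malcev.truncatedAugIdeal N₁ := fun g => (F g).2
  have hρinj : Function.Injective ρ := fun a b hab => hFinj (Subtype.ext (Units.ext hab))
  have hN₂fg : N₂.FG := (Group.fg_iff_subgroup_fg N₂).1 h₂.fg
  set B : Subalgebra ℤ A := Algebra.adjoin ℤ (Malcev.logLattice N₁ : Set A) with hB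
  have hBfg : (Subalgebra.toSubmodule B).FG :=
    Algebra.fg_adjoin_int_of_isNilpotent _ (Malcev.truncatedAugIdeal_pow N₁) _ Malcev.logLattice_fg
      Malcev.mem_truncatedAugIdeal_of_mem_logLattice
  have hBfin : Module.Finite ℤ B := Module.Finite.iff_fg.2 hBfg
  obtain ⟨B₂, hB₂fg, hB₂log, hB₂ρ⟩ := exists_fg_subalgebra_int _ (Malcev.truncatedAugIdeal_pow N₁) ρ hρJ
    hN₂fg (Malcev.logLattice N₁) Malcev.logLattice_fg Malcev.mem_truncatedAugIdeal_of_mem_logLattice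
  have hBB₂ : B ≤ B₂ := Algebra.adjoin_le hB₂log
  obtain ⟨m, hm, hmB⟩ := hB₂fg.exists_nsmul_mem (Subalgebra.toSubmodule B)
    fun x _ => Malcev.exists_nsmul_mem_adjoin_logLattice x
  obtain ⟨n, hn, hcong⟩ := exists_mem_of_map_sub_one_eq_nsmul _ (Malcev.truncatedAugIdeal_pow N₁) ρ hρJ
    hρinj N₂ hG₂.exists_pow_mem B₂ hB₂fg hB₂ρ
  obtain ⟨k, hk, hiter⟩ := exists_iterate_sub_self_eq_nsmul (M := B) (Nat.mul_pos hm hn)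
  refine ⟨(m * n).primeFactors, fun p hp => Nat.prime_of_mem_primeFactors hp, fun φ _ => ?_⟩
  obtain ⟨d, hd, hdlog⟩ := Malcev.exists_int_eq_det φ
  obtain ⟨φQ, hφQ⟩ := Subgroup.exists_extension_of_pow_mem hG₁.torsionFree hG₁.radicable
    hG₁.exists_pow_mem (N₁.subtype.comp φ)
  have hφQ' : ∀ x : N₁, φQ x = φ x := hφQ
  refine ⟨d, hd, φQ, fun ψ => ⟨fun hψ => ?_, ?_⟩, fun hS => ⟨k, hk, fun x hx => ?_⟩⟩
  · refine Subgroup.monoidHom_ext_of_pow_mem hG₁.torsionFree hG₁.exists_pow_mem fun x hx => ?_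
    exact (hψ ⟨x, hx⟩).trans (hφQ' ⟨x, hx⟩).symm
  · rintro rfl; exact hφQ'
  have hcop : IsCoprime d ((m * n : ℕ) : ℤ) := by
    rw [Int.isCoprime_iff_gcd_eq_one]
    by_contra hne
    obtain ⟨p, hp, hpd⟩ := Nat.exists_prime_and_dvd hne
    refine hS p (Nat.mem_primeFactors.2 ⟨hp, ?_, (Nat.mul_pos hm hn).ne'⟩) ?_
    · exact Int.natCast_dvd_natCast.1 ((Int.natCast_dvd_natCast.2 hpd).trans (Int.gcd_dvd_right _ _))
    · exact (Int.natCast_dvd_natCast.2 hpd).trans (Int.gcd_dvd_left _ _)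
  -- From `u * d + v * (m * n) = 1`: the part `d • x` lies in the image of the lattice by the
  -- adjugate argument.
  have hlog : ∀ x ∈ Malcev.logLattice N₁, ∃ y ∈ Malcev.logLattice N₁, ∃ z ∈ Malcev.logLattice N₁,
      x = Malcev.algMap φ y + (m * n) • z := by
    intro x hx
    obtain ⟨u, v, huv⟩ := hcop
    obtain ⟨y, hy, hxy⟩ := hdlog x hx
    refine ⟨u • y, Submodule.smul_mem _ u hy, v • x, Submodule.smul_mem _ v hx, ?_⟩
    rw [map_zsmul, ← hxy, ← natCast_zsmul, smul_smul, smul_smul, ← add_smul, mul_comm _ v, huv,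
      one_smul]
  have hαB : ∀ x ∈ B, Malcev.algMap φ x ∈ B := by
    intro x hx
    have h : B ≤ B.comap ((Malcev.algMap φ).restrictScalars ℤ) :=
      Algebra.adjoin_le fun y hy => Algebra.subset_adjoin (Malcev.algMap_mem_logLattice φ y hy)
    exact h hx
  let f : B →ₗ[ℤ] B :=
    ((((Malcev.algMap φ).restrictScalars ℤ).comp B.val).codRestrict B fun x => hαB x x.2).toLinearMap
  have hf : ∀ y : B, ∀ j : ℕ, ((f^[j] y : B) : A) = (Malcev.algMap φ)^[j] y := by
    intro y j
    induction j with
    | zero => rfl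
    | succ j ih => rw [Function.iterate_succ_apply', Function.iterate_succ_apply', ← ih]; rfl
  have hρφ : ∀ j : ℕ, ρ (φQ^[j] x) = (Malcev.algMap φ)^[j] (ρ x) := by
    intro j
    induction j with
    | zero => rfl
    | succ j ih =>
      rw [Function.iterate_succ_apply', Function.iterate_succ_apply', ← ih]
      exact (Malcev.algMap_extension hG₁ hF φ hφQ' _).symm
  -- Only `m • ρ x` is known to lie in `B`, which is why the modulus is `m * n` rather than `n`; the
  -- factor `m` is cancelled afterwards.
  obtain ⟨z, hz⟩ := hiter f (fun y => by
    obtain ⟨y₁, hy₁, z₁, hz₁, h⟩ := exists_eq_map_add_nsmul_of_mem_adjoin hlog hαB y.2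
    exact ⟨⟨y₁, hy₁⟩, ⟨z₁, hz₁⟩, Subtype.ext h⟩) ⟨m • ρ x, hmB _ (hB₂ρ x hx)⟩
  have hz' : ρ (φQ^[k] x) - ρ x = n • (z : A) := by
    have h1 := congrArg (Subtype.val : B → A) hz
    have h2 : (Malcev.algMap φ)^[k] (m • ρ x) - m • ρ x = (m * n) • (z : A) := by
      rw [← hf ⟨m • ρ x, hmB _ (hB₂ρ x hx)⟩ k]; exact h1
    have h3 : (Malcev.algMap φ)^[k] (m • ρ x) = m • (Malcev.algMap φ)^[k] (ρ x) := by
      rw [← AlgHom.coe_pow, map_nsmul]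
    rw [h3, ← hρφ, ← smul_sub, mul_smul] at h2
    have : IsAddTorsionFree A := .of_module_rat A
    exact nsmul_right_injective hm.ne' h2
  have hw : x⁻¹ * φQ^[k] x ∈ N₂ := by
    refine hcong _ (ρ x⁻¹ * z) (B₂.mul_mem (hB₂ρ _ (N₂.inv_mem hx)) (hBB₂ z.2)) ?_
    rw [← mul_smul_comm, ← hz', mul_sub, ← map_mul, ← map_mul, inv_mul_cancel, map_one]
  have := N₂.mul_mem hx hw
  rwa [mul_inv_cancel_left] at this
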